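/- Let $(M,g)$ be a $C^r$ spacetime, $r\in\{3,\dots,\infty\}$, that is, a connected, Hausdorff, second countable $C^r$ manifold of dimension $n\ge 2$ with a $C^{r-1}$ Lorentzian metric $g$ of signature $(-,+,\dots,+)$ and a time orientation. Let $I^+\subset M\times M$ be the chronological relation (pairs $(x,y)$ joined by a piecewise $C^1$ future-directed timelike curve from $x$ to $y$) and $J^+\subset M\times M$ the causal relation (pairs $(x,y)$ such that $x=y$ or there is a piecewise $C^1$ future-directed causal curve from $x$ to $y$). Put $I^+(x)=\{y:(x,y)\in I^+\}$, $I^-(y)=\{x:(x,y)\in I^+\}$ and $$D^+_f=\{(x,y): y\in\overline{I^+(x)}\},\qquad D^+_p=\{(x,y): x\in\overline{I^-(y)}\},\qquad D^+=D^+_p\cap D^+_f .$$ The spacetime is called - future reflecting if $I^-(x)\subset I^-(y)$ implies $I^+(y)\subset I^+(x)$, and past reflecting if $I^+(y)\subset I^+(x)$ implies $I^-(x)\subset I^-(y)$, for all $x,y\in M$; - future (resp. past) distinguishing if $I^+(x)=I^+(y)$ (resp. $I^-(x)=I^-(y)$) implies $x=y$, for all $x,y\in M$; - feebly distinguishing if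 $(x,y)\in J^+$, $I^+(x)=I^+(y)$ and $I^-(x)=I^-(y)$ imply $x=y$, for all $x,y\in M$. **Theorem.** If the spacetime is future reflecting, then $D^+=D^+_p$; if it is past reflecting, then $D^+=D^+_f$. In particular, a feebly distinguishing and future reflecting spacetime is past distinguishing, and a feebly distinguishing and past reflecting spacetime is future distinguishing. -/

import Mathlib

open Set Bundle
open scoped Manifold ContDiff Topology

/-- The data of a `C^r` spacetime of dimension `n` on a `C^r` manifold `M`: a Lorentzian metric of
signature `(-,+,…,+)`, which is a `C^(r-1)` section of the bundle of bilinear forms on the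
tangent bundle (with `∞ - 1 = ∞`), and a time orientation, given by a continuous timelike vector
field. -/
structure Spacetime (n : ℕ) (r : ℕ∞) (M : Type*) [TopologicalSpace M]
    [ChartedSpace (EuclideanSpace ℝ (Fin n)) M] [IsManifold (𝓡 n) 1 M] where
  /-- the metric tensor at each point -/
  metric : ∀ x : M, TangentSpace (𝓡 n) x →L[ℝ] TangentSpace (𝓡 n) x →L[ℝ] ℝ
  symm : ∀ (x : M) (v w : TangentSpace (𝓡 n) x), metric x v w = metric x w v
  /-- at each point there is an orthonormal basis exhibiting the signature `(-,+,…,+)` -/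
  signature : ∀ x : M, ∃ b : Module.Basis (Fin n) ℝ (TangentSpace (𝓡 n) x), ∀ i j : Fin n,
    metric x (b i) (b j) = if i = j then (if (i : ℕ) = 0 then -1 else 1) else 0
  contMDiff_metric :
    ContMDiff (𝓡 n)
      ((𝓡 n).prod 𝓘(ℝ, EuclideanSpace ℝ (Fin n) →L[ℝ] EuclideanSpace ℝ (Fin n) →L[ℝ] ℝ))
      ((r - 1 : ℕ∞) : ℕ∞ω)
      (fun x ↦ TotalSpace.mk'
        (EuclideanSpace ℝ (Fin n) →L[ℝ] EuclideanSpace ℝ (Fin n) →L[ℝ] ℝ) x (metric x))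
  /-- a timelike vector field, which fixes the time orientation -/
  timeField : ∀ x : M, TangentSpace (𝓡 n) x
  timeField_timelike : ∀ x : M, metric x (timeField x) (timeField x) < 0
  continuous_timeField :
    Continuous (fun x ↦ (⟨x, timeField x⟩ : TangentBundle (𝓡 n) M))

namespace Spacetime

variable {n : ℕ} {r : ℕ∞} {M : Type*} [TopologicalSpace M]
  [ChartedSpace (EuclideanSpace ℝ (Fin n)) M] [IsManifold (𝓡 n) 1 M]

/-- `v` is timelike and future-directed. -/
def IsFutureTimelike (S : Spacetime n r M) (x : M) (v : TangentSpace (𝓡 n) x) : Prop :=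
  S.metric x v v < 0 ∧ S.metric x (S.timeField x) v < 0

/-- `v` is causal (nonzero, timelike or null) and future-directed. -/
def IsFutureCausal (S : Spacetime n r M) (x : M) (v : TangentSpace (𝓡 n) x) : Prop :=
  v ≠ 0 ∧ S.metric x v v ≤ 0 ∧ S.metric x (S.timeField x) v < 0

/-- The velocity at time `t` of a curve parametrized by `[0, 1]` (one-sided at the endpoints). -/
noncomputable def velocity (n : ℕ) {M : Type*} [TopologicalSpace M]
    [ChartedSpace (EuclideanSpace ℝ (Fin n)) M] (γ : ℝ → M) (t : ℝ) :
    TangentSpace (𝓡 n) (γ t) :=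
  mfderivWithin 𝓘(ℝ, ℝ) (𝓡 n) γ (Icc (0 : ℝ) 1) t (1 : ℝ)

/-- Some `C^1` future-directed timelike curve `[0, 1] → M` goes from `x` to `y`. -/
def TimelikeSegment (S : Spacetime n r M) (x y : M) : Prop :=
  ∃ γ : ℝ → M, ContMDiffOn 𝓘(ℝ, ℝ) (𝓡 n) 1 γ (Icc (0 : ℝ) 1) ∧ γ 0 = x ∧ γ 1 = y ∧
    ∀ t ∈ Icc (0 : ℝ) 1, S.IsFutureTimelike (γ t) (velocity n γ t)

/-- Some `C^1` future-directed causal curve `[0, 1] → M` goes from `x` to `y`. -/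
def CausalSegment (S : Spacetime n r M) (x y : M) : Prop :=
  ∃ γ : ℝ → M, ContMDiffOn 𝓘(ℝ, ℝ) (𝓡 n) 1 γ (Icc (0 : ℝ) 1) ∧ γ 0 = x ∧ γ 1 = y ∧
    ∀ t ∈ Icc (0 : ℝ) 1, S.IsFutureCausal (γ t) (velocity n γ t)

/-- The chronological relation `I⁺ ⊆ M × M`: the pairs `(x, y)` such that a piecewise `C^1`
future-directed timelike curve (a finite nonempty chain of `C^1` ones) goes from `x` to `y`. -/
def chronRel (S : Spacetime n r M) : Set (M × M) :=
  {p | Relation.TransGen S.TimelikeSegment p.1 p.2}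

/-- The causal relation `J⁺ ⊆ M × M`: the pairs `(x, y)` such that `x = y` or a piecewise `C^1`
future-directed causal curve (a finite chain of `C^1` ones) goes from `x` to `y`. -/
def causalRel (S : Spacetime n r M) : Set (M × M) :=
  {p | Relation.ReflTransGen S.CausalSegment p.1 p.2}

/-- The chronological future `I⁺(x)`. -/
def chronFuture (S : Spacetime n r M) (x : M) : Set M := {y | (x, y) ∈ S.chronRel}

/-- The chronological past `I⁻(y)`. -/
def chronPast (S : Spacetime n r M) (y : M) : Set M := {x | (x, y) ∈ S.chronRel}

/-- `D⁺_f = {(x, y) : y ∈ closure I⁺(x)}`. -/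
def Df (S : Spacetime n r M) : Set (M × M) := {p | p.2 ∈ closure (S.chronFuture p.1)}

/-- `D⁺_p = {(x, y) : x ∈ closure I⁻(y)}`. -/
def Dp (S : Spacetime n r M) : Set (M × M) := {p | p.1 ∈ closure (S.chronPast p.2)}

/-- `D⁺ = D⁺_p ∩ D⁺_f`. -/
def D (S : Spacetime n r M) : Set (M × M) := S.Dp ∩ S.Df

/-- Future reflectivity: `I⁻(x) ⊆ I⁻(y)` implies `I⁺(y) ⊆ I⁺(x)`. -/
def FutureReflecting (S : Spacetime n r M) : Prop :=
  ∀ x y : M, S.chronPast x ⊆ S.chronPast y → S.chronFuture y ⊆ S.chronFuture x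

/-- Past reflectivity: `I⁺(y) ⊆ I⁺(x)` implies `I⁻(x) ⊆ I⁻(y)`. -/
def PastReflecting (S : Spacetime n r M) : Prop :=
  ∀ x y : M, S.chronFuture y ⊆ S.chronFuture x → S.chronPast x ⊆ S.chronPast y

/-- Future distinction: `I⁺(x) = I⁺(y)` implies `x = y`. -/
def FutureDistinguishing (S : Spacetime n r M) : Prop :=
  ∀ x y : M, S.chronFuture x = S.chronFuture y → x = y

/-- Past distinction: `I⁻(x) = I⁻(y)` implies `x = y`. -/
def PastDistinguishing (S : Spacetime n r M) : Prop :=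
  ∀ x y : M, S.chronPast x = S.chronPast y → x = y

/-- Feeble distinction: causally related events with the same chronological future and the same
chronological past coincide. -/
def FeeblyDistinguishing (S : Spacetime n r M) : Prop :=
  ∀ x y : M, (x, y) ∈ S.causalRel → S.chronFuture x = S.chronFuture y →
    S.chronPast x = S.chronPast y → x = y

end Spacetime

/-! Reflectivity half: if `x` lies in the closure of `I⁻(y)` and `u ≪ x`, the open set `I⁺(u)` is a
neighbourhood of `x`, hence meets `I⁻(y)`, so `I⁻(x) ⊆ I⁻(y)`. Future reflectivity gives `I⁺(y) ⊆
I⁺(x)`, and `y` lies in the closure of `I⁺(y)`, hence of `I⁺(x)` (`FutureReflecting.D_eq_Dp`). The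
past version follows by reversing the time orientation.

Distinction half: let `I⁻(x) = I⁻(y)` with `x ≠ y`. Choose points of `I⁻(y)` converging to `x`.
Timelike curves from them to `y` must leave a small ball about `x`, and their exit points accumulate
at some `z ≠ x`. Then `x ≤ z` as a limit of timelike geodesics. Moreover `I⁻(z) ⊆ I⁻(y) = I⁻(x)`
because `z` lies in the closure of `I⁻(y)`, and `I⁻(x) ⊆ I⁻(z)` by push-up
(`exists_causalRel_chronPast_eq`). Reflectivity equates the futures of `x` and `z`, against feeble
distinction.

Everything rests on local causality: inside a small ball, the endpoint of a timelike curve is joined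
to its origin by a timelike geodesic. Geodesics between nearby points come from a contraction
argument (`exists_geodesicFamily`). The energy `σ` of the geodesic from `p` to `q` has derivative `2
G(u, ·)` in `q`, where `u` is the arrival velocity (`GeodesicFamily.hasFDerivAt_energy`). The
reversed triangle-type inequality `apply_neg_of_future` makes `σ` decrease along future causal
curves, so once timelike related to `p` such a curve stays so (`IsTimelike.of_causal_curve`). This
yields openness, push-up and the control of exit points. -/

/-! ### Linear algebra of Lorentzian scalar products -/

section LorentzForm

variable {E : Type*} [NormedAddCommGroup E] [NormedSpace ℝ E]

/-- A symmetric bilinear form which is positive definite on the orthogonal complement of each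
vector on which it is negative. -/
structure IsLorentzForm (B : E →L[ℝ] E →L[ℝ] ℝ) : Prop where
  symm : ∀ v w, B v w = B w v
  pos_of_orthogonal : ∀ v w, B v v < 0 → B v w = 0 → w ≠ 0 → 0 < B w w

namespace IsLorentzForm

variable {B : E →L[ℝ] E →L[ℝ] ℝ}

theorem ne_zero_of_causal (hB : IsLorentzForm B) {T v : E} (hT : B T T < 0) (hv : B v v ≤ 0)
    (hv0 : v ≠ 0) : B T v ≠ 0 :=
  fun h ↦ (hB.pos_of_orthogonal T v hT h hv0).not_ge hv

/-- A nonzero vector of the radical would be null and orthogonal to `T`. This nondegeneracy lets the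
geodesic equation be solved for the acceleration. -/
theorem eq_zero_of_apply_eq_zero (hB : IsLorentzForm B) {T v : E} (hT : B T T < 0)
    (hv : B v = 0) : v = 0 := by
  by_contra hv0
  refine hB.ne_zero_of_causal hT (v := v) (by simp [hv]) hv0 ?_
  rw [hB.symm, hv]; rfl

/-- Two future-directed causal vectors, one of them timelike, have negative product. -/
theorem apply_neg_of_future (hB : IsLorentzForm B) {T v w : E} (hT : B T T < 0)
    (hv : B v v < 0) (hTv : B T v < 0) (hw : B w w ≤ 0) (hTw : B T w < 0) : B v w < 0 := by
  by_contra! h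
  -- With this `s`, the vector `v - s • w` is orthogonal to `T`; if `B v w ≥ 0` it would also be
  -- timelike.
  set s := B T v / B T w with hs
  have hs0 : 0 < s := div_pos_of_neg_of_neg hTv hTw
  have h0 : B T (v - s • w) = 0 := by
    simp only [map_sub, map_smul, smul_eq_mul, hs]
    field_simp [hTw.ne]; ring
  have h1 : B (v - s • w) (v - s • w) = B v v - 2 * s * B v w + s ^ 2 * B w w := by
    simp only [map_sub, map_smul, smul_eq_mul, sub_apply, smul_apply, hB.symm w v]
    ring
  have h2 : B (v - s • w) (v - s • w) < 0 := by
    rw [h1]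
    have := mul_nonneg hs0.le h
    have := mul_nonneg (sq_nonneg s) (neg_nonneg.2 hw)
    nlinarith
  by_cases hz : v - s • w = 0
  · simp [hz] at h2
  · exact (hB.pos_of_orthogonal T _ hT h0 hz).not_gt h2

/-- In orthonormal coordinates write `v = (a, V)` and `w = (c, W)`. Orthogonality says `a c = V ·
W`, so Cauchy–Schwarz and `|V|² < a²` force `c² < |W|²` unless `W = 0`, in which case `c = 0` too.
-/
theorem of_basis {n : ℕ} (hn : 0 < n) (b : Module.Basis (Fin n) ℝ E)
    (hsymm : ∀ v w, B v w = B w v)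
    (hb : ∀ i j : Fin n, B (b i) (b j) = if i = j then (if (i : ℕ) = 0 then -1 else 1) else 0) :
    IsLorentzForm B := by
  obtain ⟨m, rfl⟩ : ∃ m, n = m + 1 := ⟨n - 1, by omega⟩
  have key : ∀ v w, B v w
      = -(b.repr v 0 * b.repr w 0) + ∑ i : Fin m, b.repr v i.succ * b.repr w i.succ := by
    intro v w
    conv_lhs => rw [← b.sum_repr v, ← b.sum_repr w]
    simp only [map_sum, map_smul, FunLike.coe_sum, Finset.sum_apply,
      FunLike.coe_smul, Pi.smul_apply, hb, smul_eq_mul]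
    rw [Fin.sum_univ_succ]
    congr 1
    · simp [mul_comm]
    · refine Finset.sum_congr rfl fun i _ ↦ ?_
      simp [mul_comm]
  refine ⟨hsymm, fun v w hv hvw hw ↦ ?_⟩
  rw [key] at hv hvw ⊢
  set a := b.repr v 0
  set c := b.repr w 0
  have hcs := Finset.sum_mul_sq_le_sq_mul_sq Finset.univ (fun i : Fin m ↦ b.repr v i.succ)
    (fun i ↦ b.repr w i.succ)
  simp only [← pow_two] at hv ⊢
  have e : ∑ i : Fin m, b.repr v i.succ * b.repr w i.succ = a * c := by linarith
  rw [e] at hcs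
  have hW : 0 ≤ ∑ i : Fin m, b.repr w i.succ ^ 2 := Finset.sum_nonneg fun i _ ↦ sq_nonneg _
  have hV : 0 ≤ ∑ i : Fin m, b.repr v i.succ ^ 2 := Finset.sum_nonneg fun i _ ↦ sq_nonneg _
  have ha : 0 < a ^ 2 := by linarith
  rcases hW.eq_or_lt with h0 | hpos
  · exfalso
    have hc : c = 0 := by
      rw [← h0] at hcs
      have : (a * c) ^ 2 = 0 := le_antisymm (by linarith) (sq_nonneg _)
      have := mul_eq_zero.1 (pow_eq_zero_iff two_ne_zero |>.1 this)
      rcases this with h | h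
      · simp [h] at ha
      · exact h
    apply hw
    rw [← b.repr.map_eq_zero_iff]
    ext i
    refine Fin.cases hc (fun j ↦ ?_) i
    have := (Finset.sum_eq_zero_iff_of_nonneg (fun i _ ↦ sq_nonneg _)).1 h0.symm j
      (Finset.mem_univ _)
    simpa using this
  · nlinarith

end IsLorentzForm

end LorentzForm

/-! ### Two-point boundary value problems by contraction -/

section BoundaryValueProblem

variable {E : Type*} [NormedAddCommGroup E]

/-- The extension of a continuous function on `[0, 1]` which is constant on both sides. -/
noncomputable def unitExtend (a : C(Icc (0 : ℝ) 1, E)) : ℝ → E := IccExtend zero_le_one a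

theorem continuous_unitExtend (a : C(Icc (0 : ℝ) 1, E)) : Continuous (unitExtend a) :=
  a.continuous.Icc_extend'

theorem unitExtend_sub_apply (a b : C(Icc (0 : ℝ) 1, E)) (t : ℝ) :
    unitExtend (a - b) t = unitExtend a t - unitExtend b t := rfl

theorem norm_unitExtend_le (a : C(Icc (0 : ℝ) 1, E)) (t : ℝ) : ‖unitExtend a t‖ ≤ ‖a‖ :=
  a.norm_coe_le_norm _

variable [NormedSpace ℝ E]

/-- The primitive on `[0, 1]` vanishing at `0`. -/
noncomputable def unitPrimitive (a : C(Icc (0 : ℝ) 1, E)) (t : ℝ) : E :=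
  ∫ s in (0 : ℝ)..t, unitExtend a s

/-- The second primitive on `[0, 1]` vanishing to first order at `0`. -/
noncomputable def unitPrimitive₂ (a : C(Icc (0 : ℝ) 1, E)) (t : ℝ) : E :=
  ∫ s in (0 : ℝ)..t, unitPrimitive a s

/-- The curve with acceleration `a` from `p` to `q`. -/
noncomputable def bvpCurve (p q : E) (a : C(Icc (0 : ℝ) 1, E)) (t : ℝ) : E :=
  p + t • (q - p) + (unitPrimitive₂ a t - t • unitPrimitive₂ a 1)

/-- The velocity of the curve with acceleration `a` from `p` to `q`. -/
noncomputable def bvpVelocity (p q : E) (a : C(Icc (0 : ℝ) 1, E)) (t : ℝ) : E :=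
  q - p + (unitPrimitive a t - unitPrimitive₂ a 1)

theorem bvpCurve_zero (p q : E) (a : C(Icc (0 : ℝ) 1, E)) : bvpCurve p q a 0 = p := by
  simp [bvpCurve, unitPrimitive₂]

theorem bvpCurve_one (p q : E) (a : C(Icc (0 : ℝ) 1, E)) : bvpCurve p q a 1 = q := by
  simp [bvpCurve]

theorem norm_unitPrimitive_le (a : C(Icc (0 : ℝ) 1, E)) {t : ℝ} (ht : t ∈ Icc (0 : ℝ) 1) :
    ‖unitPrimitive a t‖ ≤ ‖a‖ := by
  have := intervalIntegral.norm_integral_le_of_norm_le_const (a := 0) (b := t)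
    (f := unitExtend a) (C := ‖a‖) fun s _ ↦ norm_unitExtend_le a s
  refine this.trans ?_
  rw [sub_zero, abs_of_nonneg ht.1]
  exact mul_le_of_le_one_right (norm_nonneg _) ht.2

theorem norm_unitPrimitive₂_le (a : C(Icc (0 : ℝ) 1, E)) {t : ℝ} (ht : t ∈ Icc (0 : ℝ) 1) :
    ‖unitPrimitive₂ a t‖ ≤ ‖a‖ := by
  have := intervalIntegral.norm_integral_le_of_norm_le_const (a := 0) (b := t)
    (f := unitPrimitive a) (C := ‖a‖) fun s hs ↦ by
      rw [uIoc_of_le ht.1] at hs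
      exact norm_unitPrimitive_le a ⟨hs.1.le, hs.2.trans ht.2⟩
  refine this.trans ?_
  rw [sub_zero, abs_of_nonneg ht.1]
  exact mul_le_of_le_one_right (norm_nonneg _) ht.2

theorem unitPrimitive_sub (a b : C(Icc (0 : ℝ) 1, E)) (t : ℝ) :
    unitPrimitive (a - b) t = unitPrimitive a t - unitPrimitive b t := by
  simp only [unitPrimitive, unitExtend_sub_apply]
  exact intervalIntegral.integral_sub ((continuous_unitExtend a).intervalIntegrable _ _)
    ((continuous_unitExtend b).intervalIntegrable _ _)

variable [CompleteSpace E]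

theorem hasDerivAt_unitPrimitive (a : C(Icc (0 : ℝ) 1, E)) (t : ℝ) :
    HasDerivAt (unitPrimitive a) (unitExtend a t) t :=
  (continuous_unitExtend a).integral_hasStrictDerivAt 0 t |>.hasDerivAt

theorem continuous_unitPrimitive (a : C(Icc (0 : ℝ) 1, E)) : Continuous (unitPrimitive a) :=
  continuous_iff_continuousAt.2 fun t ↦ (hasDerivAt_unitPrimitive a t).continuousAt

theorem hasDerivAt_unitPrimitive₂ (a : C(Icc (0 : ℝ) 1, E)) (t : ℝ) :
    HasDerivAt (unitPrimitive₂ a) (unitPrimitive a t) t :=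
  (continuous_unitPrimitive a).integral_hasStrictDerivAt 0 t |>.hasDerivAt

theorem unitPrimitive₂_sub (a b : C(Icc (0 : ℝ) 1, E)) (t : ℝ) :
    unitPrimitive₂ (a - b) t = unitPrimitive₂ a t - unitPrimitive₂ b t := by
  simp only [unitPrimitive₂, unitPrimitive_sub]
  exact intervalIntegral.integral_sub ((continuous_unitPrimitive a).intervalIntegrable _ _)
    ((continuous_unitPrimitive b).intervalIntegrable _ _)

theorem hasDerivAt_bvpCurve (p q : E) (a : C(Icc (0 : ℝ) 1, E)) (t : ℝ) :
    HasDerivAt (bvpCurve p q a) (bvpVelocity p q a t) t := by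
  have h := (((hasDerivAt_id t).smul_const (q - p)).const_add p).add
    ((hasDerivAt_unitPrimitive₂ a t).sub ((hasDerivAt_id t).smul_const (unitPrimitive₂ a 1)))
  simpa only [one_smul] using! h

theorem hasDerivAt_bvpVelocity (p q : E) (a : C(Icc (0 : ℝ) 1, E)) (t : ℝ) :
    HasDerivAt (bvpVelocity p q a) (unitExtend a t) t :=
  ((hasDerivAt_unitPrimitive a t).sub_const _).const_add _

/-- The affine part is a convex combination of the endpoints, and each of the two second primitives
is bounded by the norm of the acceleration. The factor `2`, against a right-hand side with Lipschitz
constant `1 / 4`, gives contraction ratio `1 / 2`. -/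
theorem norm_bvpCurve_sub_le (p q p' q' : E) (a a' : C(Icc (0 : ℝ) 1, E)) {t : ℝ}
    (ht : t ∈ Icc (0 : ℝ) 1) :
    ‖bvpCurve p q a t - bvpCurve p' q' a' t‖ ≤ ‖p - p'‖ + ‖q - q'‖ + 2 * ‖a - a'‖ := by
  have e : bvpCurve p q a t - bvpCurve p' q' a' t = (1 - t) • (p - p') + t • (q - q')
      + (unitPrimitive₂ (a - a') t - t • unitPrimitive₂ (a - a') 1) := by
    simp only [bvpCurve, unitPrimitive₂_sub]
    module
  have h1 : ‖(1 - t) • (p - p')‖ ≤ ‖p - p'‖ := by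
    rw [norm_smul, Real.norm_of_nonneg (by linarith [ht.2])]
    exact mul_le_of_le_one_left (norm_nonneg _) (by linarith [ht.1])
  have h2 : ‖t • (q - q')‖ ≤ ‖q - q'‖ := by
    rw [norm_smul, Real.norm_of_nonneg ht.1]
    exact mul_le_of_le_one_left (norm_nonneg _) ht.2
  have h3 : ‖t • unitPrimitive₂ (a - a') 1‖ ≤ ‖a - a'‖ := by
    rw [norm_smul, Real.norm_of_nonneg ht.1]
    exact (mul_le_of_le_one_left (norm_nonneg _) ht.2).trans
      (norm_unitPrimitive₂_le _ (right_mem_Icc.2 zero_le_one))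
  have h4 := norm_unitPrimitive₂_le (a - a') ht
  rw [e]
  calc _ ≤ ‖(1 - t) • (p - p')‖ + ‖t • (q - q')‖
        + (‖unitPrimitive₂ (a - a') t‖ + ‖t • unitPrimitive₂ (a - a') 1‖) :=
        (norm_add_le _ _).trans (add_le_add (norm_add_le _ _) (norm_sub_le _ _))
    _ ≤ _ := by linarith

theorem norm_bvpVelocity_sub_le (p q p' q' : E) (a a' : C(Icc (0 : ℝ) 1, E)) {t : ℝ}
    (ht : t ∈ Icc (0 : ℝ) 1) :
    ‖bvpVelocity p q a t - bvpVelocity p' q' a' t‖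
      ≤ ‖p - p'‖ + ‖q - q'‖ + 2 * ‖a - a'‖ := by
  have e : bvpVelocity p q a t - bvpVelocity p' q' a' t = ((q - q') - (p - p'))
      + (unitPrimitive (a - a') t - unitPrimitive₂ (a - a') 1) := by
    simp only [bvpVelocity, unitPrimitive₂_sub, unitPrimitive_sub]
    module
  have h3 := norm_unitPrimitive₂_le (a - a') (right_mem_Icc.2 (zero_le_one' ℝ))
  have h4 := norm_unitPrimitive_le (a - a') ht
  rw [e]
  calc _ ≤ (‖q - q'‖ + ‖p - p'‖)
        + (‖unitPrimitive (a - a') t‖ + ‖unitPrimitive₂ (a - a') 1‖) :=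
        (norm_add_le _ _).trans (add_le_add (norm_sub_le _ _) (norm_sub_le _ _))
    _ ≤ _ := by linarith

/-- Solutions of the two-point boundary value problem `c'' = N (c, c')`, `c 0 = p`, `c 1 = q` for
a right-hand side with small Lipschitz constant, with Lipschitz dependence on the endpoints. -/
theorem exists_boundary_value_solutions {N : E × E → E} (hN : LipschitzWith (1 / 4) N) :
    ∃ c u : E → E → ℝ → E,
      (∀ p q, c p q 0 = p) ∧ (∀ p q, c p q 1 = q) ∧
      (∀ p q t, HasDerivAt (c p q) (u p q t) t) ∧
      (∀ p q, ∀ t ∈ Icc (0 : ℝ) 1, HasDerivAt (u p q) (N (c p q t, u p q t)) t) ∧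
      (∀ p q, Continuous (u p q)) ∧
      (∀ p q p' q', ∀ t ∈ Icc (0 : ℝ) 1,
        ‖c p q t - c p' q' t‖ ≤ 2 * (‖p - p'‖ + ‖q - q'‖)) ∧
      (∀ p q p' q', ∀ t ∈ Icc (0 : ℝ) 1,
        ‖u p q t - u p' q' t‖ ≤ 2 * (‖p - p'‖ + ‖q - q'‖)) ∧
      (∀ p, N (p, 0) = 0 → ∀ t ∈ Icc (0 : ℝ) 1, c p p t = p ∧ u p p t = 0) := by
  have hcc : ∀ p q a, Continuous (bvpCurve (E := E) p q a) := fun p q a ↦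
    continuous_iff_continuousAt.2 fun t ↦ (hasDerivAt_bvpCurve p q a t).continuousAt
  have huc : ∀ p q a, Continuous (bvpVelocity (E := E) p q a) := fun p q a ↦
    continuous_iff_continuousAt.2 fun t ↦ (hasDerivAt_bvpVelocity p q a t).continuousAt
  -- The unknown is the acceleration: both endpoint conditions are built into `bvpCurve`, and
  -- solutions are the fixed points of `F p q`.
  let F : E → E → C(Icc (0 : ℝ) 1, E) → C(Icc (0 : ℝ) 1, E) := fun p q a ↦
    ⟨fun t ↦ N (bvpCurve p q a t, bvpVelocity p q a t), hN.continuous.comp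
      (((hcc p q a).comp continuous_subtype_val).prodMk
        ((huc p q a).comp continuous_subtype_val))⟩
  have hF : ∀ p q a p' q' a', ‖F p q a - F p' q' a'‖
      ≤ 1 / 4 * (‖p - p'‖ + ‖q - q'‖ + 2 * ‖a - a'‖) := by
    intro p q a p' q' a'
    rw [ContinuousMap.norm_le _ (by positivity)]
    intro t
    have h1 : ‖(F p q a - F p' q' a') t‖ ≤ _ := hN.norm_sub_le
      (bvpCurve p q a t, bvpVelocity p q a t) (bvpCurve p' q' a' t, bvpVelocity p' q' a' t)
    refine h1.trans ?_
    have h2 : ‖(bvpCurve p q a t, bvpVelocity p q a t)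
        - (bvpCurve p' q' a' t, bvpVelocity p' q' a' t)‖
        ≤ ‖p - p'‖ + ‖q - q'‖ + 2 * ‖a - a'‖ := by
      rw [Prod.mk_sub_mk, Prod.norm_mk]
      exact max_le (norm_bvpCurve_sub_le _ _ _ _ _ _ t.2) (norm_bvpVelocity_sub_le _ _ _ _ _ _ t.2)
    have h3 : ((1 / 4 : NNReal) : ℝ) = 1 / 4 := by norm_num
    rw [h3]
    linarith
  have hcontr : ∀ p q, ContractingWith (1 / 2) (F p q) := fun p q ↦ by
    refine ⟨by rw [← NNReal.coe_lt_coe]; norm_num, LipschitzWith.of_dist_le_mul fun a b ↦ ?_⟩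
    have h3 : ((1 / 2 : NNReal) : ℝ) = 1 / 2 := by norm_num
    rw [dist_eq_norm, dist_eq_norm, h3]
    have := hF p q a p q b
    simp only [sub_self, norm_zero] at this
    linarith
  let a : E → E → C(Icc (0 : ℝ) 1, E) := fun p q ↦ (hcontr p q).fixedPoint
  have ha : ∀ p q, F p q (a p q) = a p q := fun p q ↦ (hcontr p q).fixedPoint_isFixedPt
  -- Insert the fixed points into `hF` and absorb the acceleration term of the right side; the curve
  -- estimates then have total constant `2`.
  have hdiff : ∀ p q p' q', 2 * ‖a p q - a p' q'‖ ≤ ‖p - p'‖ + ‖q - q'‖ := by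
    intro p q p' q'
    have := hF p q (a p q) p' q' (a p' q')
    rw [ha, ha] at this
    linarith
  refine ⟨fun p q ↦ bvpCurve p q (a p q), fun p q ↦ bvpVelocity p q (a p q),
    fun p q ↦ bvpCurve_zero _ _ _, fun p q ↦ bvpCurve_one _ _ _,
    fun p q t ↦ hasDerivAt_bvpCurve _ _ _ _, fun p q t ht ↦ ?_, fun p q ↦ huc _ _ _,
    fun p q p' q' t ht ↦ ?_, fun p q p' q' t ht ↦ ?_, fun p hp t ht ↦ ?_⟩
  · have h := hasDerivAt_bvpVelocity p q (a p q) t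
    have e : unitExtend (a p q) t = F p q (a p q) ⟨t, ht⟩ := by
      rw [ha, unitExtend, IccExtend_of_mem _ _ ht]
    rwa [e] at h
  · linarith [norm_bvpCurve_sub_le p q p' q' (a p q) (a p' q') ht, hdiff p q p' q']
  · linarith [norm_bvpVelocity_sub_le p q p' q' (a p q) (a p' q') ht, hdiff p q p' q']
  -- A constant curve has zero acceleration, so by uniqueness it is the solution when `N (p, 0) =
  -- 0`.
  · have hA : ∀ s, unitPrimitive (0 : C(Icc (0 : ℝ) 1, E)) s = 0 := fun s ↦ by
      simpa using unitPrimitive_sub (0 : C(Icc (0 : ℝ) 1, E)) 0 s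
    have hB : ∀ s, unitPrimitive₂ (0 : C(Icc (0 : ℝ) 1, E)) s = 0 := fun s ↦ by
      simpa using unitPrimitive₂_sub (0 : C(Icc (0 : ℝ) 1, E)) 0 s
    have h0 : a p p = 0 := by
      refine ((hcontr p p).fixedPoint_unique ?_).symm
      ext s
      simp [F, bvpCurve, bvpVelocity, hA, hB, hp]
    simp [h0, bvpCurve, bvpVelocity, hA, hB]

end BoundaryValueProblem

/-! ### Geodesics between nearby points -/

section Geodesics

variable {E : Type*} [NormedAddCommGroup E] [NormedSpace ℝ E]

set_option synthInstance.maxHeartbeats 200000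

noncomputable instance BilinForm.normedAddCommGroup :
    NormedAddCommGroup (E →L[ℝ] E →L[ℝ] ℝ) := inferInstance

noncomputable instance BilinForm.normedSpace : NormedSpace ℝ (E →L[ℝ] E →L[ℝ] ℝ) := inferInstance

noncomputable instance TrilinForm.normedAddCommGroup :
    NormedAddCommGroup (E →L[ℝ] E →L[ℝ] E →L[ℝ] ℝ) := inferInstance

noncomputable instance TrilinForm.normedSpace :
    NormedSpace ℝ (E →L[ℝ] E →L[ℝ] E →L[ℝ] ℝ) := inferInstance

/-- The covector `w ↦ ½ ∂_w G (v, v) - ∂_v G (v, w)`, the right-hand side of the geodesic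
equation `G (c'', w) = ½ ∂_w G (c', c') - ∂_{c'} G (c', w)`. -/
noncomputable def geodesicForce (G : E → E →L[ℝ] E →L[ℝ] ℝ) (x v : E) : E →L[ℝ] ℝ :=
  (1 / 2 : ℝ) • ((fderiv ℝ G x).flip v).flip v - fderiv ℝ G x v v

theorem geodesicForce_apply (G : E → E →L[ℝ] E →L[ℝ] ℝ) (x v w : E) :
    geodesicForce G x v w = 1 / 2 * fderiv ℝ G x w v v - fderiv ℝ G x v v w := rfl

/-- The force is quadratic in the velocity; the two terms contribute `1 / 2 + 1`, rounded up to `2`.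
-/
theorem norm_geodesicForce_le (G : E → E →L[ℝ] E →L[ℝ] ℝ) (x v : E) :
    ‖geodesicForce G x v‖ ≤ 2 * ‖fderiv ℝ G x‖ * ‖v‖ ^ 2 := by
  refine ContinuousLinearMap.opNorm_le_bound _ (by positivity) fun w ↦ ?_
  have h : ∀ a b c : E, ‖fderiv ℝ G x a b c‖ ≤ ‖fderiv ℝ G x‖ * ‖a‖ * ‖b‖ * ‖c‖ := fun a b c ↦
    ((fderiv ℝ G x a b).le_opNorm c).trans
      (mul_le_mul_of_nonneg_right ((fderiv ℝ G x).le_opNorm₂ a b) (norm_nonneg _))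
  rw [geodesicForce_apply]
  refine (norm_sub_le _ _).trans ?_
  rw [norm_mul, show ‖(1 / 2 : ℝ)‖ = 1 / 2 by norm_num]
  have h1 := h w v v
  have h2 := h v v w
  have : 0 ≤ ‖fderiv ℝ G x‖ * ‖v‖ * ‖v‖ * ‖w‖ := by positivity
  nlinarith

/-- Geodesics `t ↦ curve p q t` of `G`, parametrized by `[0, 1]`, which join the points `p` and `q`
of the ball of radius `ρ` about `x₀`, stay in the ball of radius `4 ρ` and depend in a Lipschitz
way on `p` and `q`. -/
structure GeodesicFamily (G : E → E →L[ℝ] E →L[ℝ] ℝ) (x₀ : E) (ρ : ℝ) where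
  curve : E → E → ℝ → E
  velocity : E → E → ℝ → E
  accel : E → E → ℝ → E
  curve_zero : ∀ p q, curve p q 0 = p
  curve_one : ∀ p q, curve p q 1 = q
  hasDerivAt_curve : ∀ p q t, HasDerivAt (curve p q) (velocity p q t) t
  continuous_velocity : ∀ p q, Continuous (velocity p q)
  hasDerivAt_velocity : ∀ p ∈ Metric.ball x₀ ρ, ∀ q ∈ Metric.ball x₀ ρ, ∀ t ∈ Icc (0 : ℝ) 1,
    HasDerivAt (velocity p q) (accel p q t) t
  geodesic : ∀ p ∈ Metric.ball x₀ ρ, ∀ q ∈ Metric.ball x₀ ρ, ∀ t ∈ Icc (0 : ℝ) 1,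
    G (curve p q t) (accel p q t) = geodesicForce G (curve p q t) (velocity p q t)
  norm_curve_sub_le : ∀ p q p' q', ∀ t ∈ Icc (0 : ℝ) 1,
    ‖curve p q t - curve p' q' t‖ ≤ 2 * (‖p - p'‖ + ‖q - q'‖)
  norm_velocity_sub_le : ∀ p q p' q', ∀ t ∈ Icc (0 : ℝ) 1,
    ‖velocity p q t - velocity p' q' t‖ ≤ 2 * (‖p - p'‖ + ‖q - q'‖)
  curve_self : ∀ p ∈ Metric.ball x₀ ρ, ∀ t ∈ Icc (0 : ℝ) 1, curve p p t = p
  velocity_self : ∀ p ∈ Metric.ball x₀ ρ, ∀ t ∈ Icc (0 : ℝ) 1, velocity p p t = 0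
  bound : ℝ
  bound_lt : bound * (2 * ρ) < 1
  norm_velocity_sub_sub_le : ∀ p ∈ Metric.ball x₀ ρ, ∀ q ∈ Metric.ball x₀ ρ, ∀ t ∈ Icc (0 : ℝ) 1,
    ‖velocity p q t - (q - p)‖ ≤ bound * ‖q - p‖ ^ 2

variable [FiniteDimensional ℝ E]

theorem exists_continuousLinearEquiv_of_nondegenerate (B : E →L[ℝ] E →L[ℝ] ℝ)
    (hB : ∀ v, B v = 0 → v = 0) : ∃ e : E ≃L[ℝ] (E →L[ℝ] ℝ), (e : E →L[ℝ] E →L[ℝ] ℝ) = B := by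
  have hinj : Function.Injective (B : E →ₗ[ℝ] E →L[ℝ] ℝ) :=
    (injective_iff_map_eq_zero _).2 fun v hv ↦ hB v hv
  have hdim : Module.finrank ℝ E = Module.finrank ℝ (E →L[ℝ] ℝ) := by
    rw [← (LinearMap.toContinuousLinearMap (𝕜 := ℝ) (E := E) (F' := ℝ)).finrank_eq]
    exact (Subspace.dual_finrank_eq (K := ℝ) (V := E)).symm
  exact ⟨((B : E →ₗ[ℝ] E →L[ℝ] ℝ).linearEquivOfInjective hinj hdim).toContinuousLinearEquiv,
    by ext v w; rfl⟩

/-- The acceleration of a geodesic through `x` with velocity `v`. -/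
noncomputable def geodesicAccel (G : E → E →L[ℝ] E →L[ℝ] ℝ) (z : E × E) : E :=
  -- `inverse` is zero at a degenerate form; only base points where the form is nondegenerate are
  -- used below.
  (G z.1).inverse (geodesicForce G z.1 z.2)

/-- The force contains one derivative of the `C²` metric, and inversion is smooth at invertible
maps, so the acceleration is `C¹`, hence strictly differentiable. -/
theorem contDiffAt_geodesicAccel {G : E → E →L[ℝ] E →L[ℝ] ℝ} {x v : E} (hG : ContDiffAt ℝ 2 G x)
    (hnd : ∀ w, G x w = 0 → w = 0) : ContDiffAt ℝ 1 (geodesicAccel G) (x, v) := by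
  obtain ⟨e, he⟩ := exists_continuousLinearEquiv_of_nondegenerate (G x) hnd
  have h1 : ContDiffAt ℝ 1 (fun z : E × E ↦ (G z.1).inverse) (x, v) := by
    have h := contDiffAt_map_inverse (𝕜 := ℝ) (n := 1) e
    rw [he] at h
    exact ContDiffAt.comp (g := ContinuousLinearMap.inverse) (x, v) h
      ((hG.of_le one_le_two).comp (x, v) contDiffAt_fst)
  have h2 : ContDiffAt ℝ 1 (fun z : E × E ↦ fderiv ℝ G z.1) (x, v) :=
    ContDiffAt.comp (x, v) (hG.fderiv_right (m := 1) (by norm_num)) contDiffAt_fst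
  have h3 : ContDiffAt ℝ 1 (fun z : E × E ↦ z.2) (x, v) := contDiffAt_snd
  have h4 : ContDiffAt ℝ 1 (fun z : E × E ↦ (fderiv ℝ G z.1).flip) (x, v) :=
    (ContinuousLinearMap.flipₗᵢ ℝ E E (E →L[ℝ] ℝ)).contDiff.contDiffAt.comp (x, v) h2
  have h5 : ContDiffAt ℝ 1 (fun z : E × E ↦ ((fderiv ℝ G z.1).flip z.2).flip) (x, v) :=
    (ContinuousLinearMap.flipₗᵢ ℝ E E ℝ).contDiff.contDiffAt.comp (x, v) (h4.clm_apply h3)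
  have h6 : ContDiffAt ℝ 1 (fun z : E × E ↦ geodesicForce G z.1 z.2) (x, v) :=
    ContDiffAt.sub (ContDiffAt.const_smul (1 / 2 : ℝ) (h5.clm_apply h3))
      ((h2.clm_apply h3).clm_apply h3)
  exact h1.clm_apply h6

/-- The quadratic bound serves twice: it makes the derivative of the acceleration vanish at zero
velocity, and it measures the deviation of a short geodesic from a straight line. -/
theorem exists_norm_geodesicAccel_le {G : E → E →L[ℝ] E →L[ℝ] ℝ} {x : E} (hG : ContDiffAt ℝ 2 G x)
    (hnd : ∀ w, G x w = 0 → w = 0) :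
    ∃ K : ℝ, 0 ≤ K ∧ ∀ᶠ y in 𝓝 x, ∀ v, ‖geodesicAccel G (y, v)‖ ≤ K * ‖v‖ ^ 2 := by
  obtain ⟨e, he⟩ := exists_continuousLinearEquiv_of_nondegenerate (G x) hnd
  have h1 : ContinuousAt (fun y ↦ (G y).inverse) x := by
    have h := (contDiffAt_map_inverse (𝕜 := ℝ) (n := 1) e).continuousAt
    rw [he] at h
    exact ContinuousAt.comp (g := ContinuousLinearMap.inverse) h hG.continuousAt
  have h2 : ContinuousAt (fderiv ℝ G) x :=
    (hG.fderiv_right (m := 1) (by norm_num)).continuousAt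
  have h1' : ContinuousAt (fun y ↦ ‖(G y).inverse‖) x :=
    (continuous_norm (E := (E →L[ℝ] ℝ) →L[ℝ] E)).continuousAt.comp h1
  have h3 : ContinuousAt (fun y ↦ ‖(G y).inverse‖ * (2 * ‖fderiv ℝ G y‖)) x :=
    h1'.fun_mul (continuousAt_const.fun_mul h2.norm)
  refine ⟨‖(G x).inverse‖ * (2 * ‖fderiv ℝ G x‖) + 1, by positivity, ?_⟩
  filter_upwards [h3.eventually (eventually_le_nhds (lt_add_one _))] with y hy v
  calc ‖geodesicAccel G (y, v)‖ ≤ ‖(G y).inverse‖ * ‖geodesicForce G y v‖ :=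
        (G y).inverse.le_opNorm _
    _ ≤ ‖(G y).inverse‖ * (2 * ‖fderiv ℝ G y‖ * ‖v‖ ^ 2) :=
        mul_le_mul_of_nonneg_left (norm_geodesicForce_le G y v)
          (ContinuousLinearMap.opNorm_nonneg _)
    _ = ‖(G y).inverse‖ * (2 * ‖fderiv ℝ G y‖) * ‖v‖ ^ 2 := by ring
    _ ≤ _ := mul_le_mul_of_nonneg_right hy (sq_nonneg _)

/-- Near `(x₀, 0)` the acceleration has arbitrarily small Lipschitz constant. Extend it to all of `E
× E`, solve the global boundary value problem, and take endpoints so close to `x₀` that the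
solutions stay where the extension agrees with the original. -/
theorem exists_geodesicFamily {G : E → E →L[ℝ] E →L[ℝ] ℝ} {x₀ : E} (hG : ContDiffAt ℝ 2 G x₀)
    (hnd : ∀ᶠ x in 𝓝 x₀, ∀ w, G x w = 0 → w = 0) {R : ℝ} (hR : 0 < R) :
    ∃ ρ, 0 < ρ ∧ 4 * ρ ≤ R ∧ Nonempty (GeodesicFamily G x₀ ρ) := by
  obtain ⟨K, hK0, hK⟩ := exists_norm_geodesicAccel_le hG hnd.self_of_nhds
  have hcd := contDiffAt_geodesicAccel (v := 0) hG hnd.self_of_nhds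
  have hder : HasFDerivAt (geodesicAccel G) (0 : E × E →L[ℝ] E) (x₀, 0) := by
    refine Asymptotics.IsBigO.hasFDerivAt (n := 2) (.of_bound K ?_) one_lt_two
    filter_upwards [continuousAt_fst.eventually (show ∀ᶠ y in 𝓝 (x₀, (0 : E)).1, _ from hK)]
      with z hz
    have h1 : ‖z.2‖ ≤ ‖z - (x₀, 0)‖ := by
      have := norm_snd_le (z - (x₀, 0))
      rwa [Prod.snd_sub, sub_zero] at this
    rw [norm_pow, norm_norm]
    exact (hz z.2).trans (by gcongr)
  have hstrict : HasStrictFDerivAt (geodesicAccel G) (0 : E × E →L[ℝ] E) (x₀, 0) := by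
    have := hcd.hasStrictFDerivAt one_ne_zero
    rwa [hder.fderiv] at this
  -- Lipschitz extension to a vector-valued map multiplies the constant; dividing beforehand leaves
  -- exactly `1 / 4`.
  set k : NNReal := 1 / 4 / (lipschitzExtensionConstant E) with hk
  have hL : 0 < lipschitzExtensionConstant E := lipschitzExtensionConstant_pos E
  obtain ⟨s, hs, hlip⟩ := hstrict.exists_lipschitzOnWith_of_nnnorm_lt k (by
    rw [nnnorm_zero]; exact div_pos (by norm_num) hL)
  obtain ⟨N, hN, hNs⟩ := hlip.extend_finite_dimension
  rw [hk, mul_div_cancel₀ _ hL.ne'] at hN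
  obtain ⟨δ, hδ, hδs⟩ := Metric.mem_nhds_iff.1
    (Filter.inter_mem hs (continuousAt_fst.preimage_mem_nhds
      (show _ ∈ 𝓝 (x₀, (0 : E)).1 from Filter.inter_mem hK hnd)))
  have hball : ∀ x v, ‖x - x₀‖ < δ → ‖v‖ < δ → (x, v) ∈ s ∧
      (∀ v, ‖geodesicAccel G (x, v)‖ ≤ K * ‖v‖ ^ 2) ∧ ∀ w, G x w = 0 → w = 0 := by
    intro x v hx hv
    refine hδs ?_
    rw [mem_ball_iff_norm, Prod.mk_sub_mk, Prod.norm_mk, sub_zero]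
    exact max_lt hx hv
  obtain ⟨c, u, hc0, hc1, hdc, hdu, hcu, hcl, hul, hself⟩ := exists_boundary_value_solutions hN
  -- `4 * ρ ≤ δ` keeps curve and velocity in the region of agreement; the last inequality becomes
  -- `bound_lt`.
  obtain ⟨ρ, hρ, hρδ, hρR, hρK⟩ : ∃ ρ : ℝ, 0 < ρ ∧ 4 * ρ ≤ δ ∧ 4 * ρ ≤ R ∧
      4 * K * 2 * (2 * ρ) < 1 := by
    have h1 := div_pos one_pos (show 0 < 16 * K + 1 by linarith)
    refine ⟨min (min δ R / 4) (1 / (16 * K + 1)), lt_min (by have := lt_min hδ hR; linarith) h1,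
      ?_, ?_, ?_⟩
    · linarith [min_le_left (min δ R / 4) (1 / (16 * K + 1)), min_le_left δ R]
    · linarith [min_le_left (min δ R / 4) (1 / (16 * K + 1)), min_le_right δ R]
    · have h2 := mul_le_mul_of_nonneg_left
        (min_le_right (min δ R / 4) (1 / (16 * K + 1))) (show 0 ≤ 16 * K by linarith)
      have h3 : 16 * K * (1 / (16 * K + 1)) < 1 := by
        rw [mul_one_div, div_lt_one (by linarith)]; linarith
      linarith
  have hself' : ∀ p ∈ Metric.ball x₀ ρ, ∀ t ∈ Icc (0 : ℝ) 1, c p p t = p ∧ u p p t = 0 := by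
    intro p hp
    refine hself p ?_
    rw [mem_ball_iff_norm] at hp
    have h := hball p 0 (by linarith) (by simpa using hδ)
    rw [← hNs h.1]
    have := h.2.1 0
    simpa using this
  have hx₀ : x₀ ∈ Metric.ball x₀ ρ := Metric.mem_ball_self hρ
  have hun : ∀ p ∈ Metric.ball x₀ ρ, ∀ q, ∀ t ∈ Icc (0 : ℝ) 1, ‖u p q t‖ ≤ 2 * ‖q - p‖ := by
    intro p hp q t ht
    have := hul p q p p t ht
    rwa [(hself' p hp t ht).2, sub_zero, sub_self, norm_zero, zero_add] at this
  have hin : ∀ p ∈ Metric.ball x₀ ρ, ∀ q ∈ Metric.ball x₀ ρ, ∀ t ∈ Icc (0 : ℝ) 1,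
      ‖c p q t - x₀‖ < δ ∧ ‖u p q t‖ < δ := by
    intro p hp q hq t ht
    have h1 := hcl p q x₀ x₀ t ht
    rw [(hself' x₀ hx₀ t ht).1] at h1
    have h2 := hun p hp q t ht
    rw [mem_ball_iff_norm] at hp hq
    have h3 : ‖q - p‖ ≤ ‖q - x₀‖ + ‖p - x₀‖ := by
      rw [← sub_sub_sub_cancel_right q p x₀]; exact norm_sub_le _ _
    constructor <;> linarith
  refine ⟨ρ, hρ, hρR, ⟨?_⟩⟩
  refine
  { curve := c
    velocity := u
    accel := fun p q t ↦ N (c p q t, u p q t)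
    curve_zero := hc0
    curve_one := hc1
    hasDerivAt_curve := hdc
    continuous_velocity := hcu
    hasDerivAt_velocity := fun p _ q _ t ht ↦ hdu p q t ht
    geodesic := fun p hp q hq t ht ↦ ?_
    norm_curve_sub_le := hcl
    norm_velocity_sub_le := hul
    curve_self := fun p hp t ht ↦ (hself' p hp t ht).1
    velocity_self := fun p hp t ht ↦ (hself' p hp t ht).2
    bound := 4 * K * 2
    bound_lt := hρK
    norm_velocity_sub_sub_le := fun p hp q hq t ht ↦ ?_ }
  · obtain ⟨h1, h2⟩ := hin p hp q hq t ht
    obtain ⟨h3, -, h4⟩ := hball _ _ h1 h2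
    rw [← hNs h3, geodesicAccel]
    obtain ⟨e, he⟩ := exists_continuousLinearEquiv_of_nondegenerate _ h4
    simp only [← he, ContinuousLinearMap.inverse_equiv]
    exact e.apply_symm_apply _
  · have hacc : ∀ τ ∈ Icc (0 : ℝ) 1, ‖N (c p q τ, u p q τ)‖ ≤ 4 * K * ‖q - p‖ ^ 2 := by
      intro τ hτ
      obtain ⟨h1, h2⟩ := hin p hp q hq τ hτ
      obtain ⟨h3, h4, -⟩ := hball _ _ h1 h2
      rw [← hNs h3]
      calc _ ≤ K * ‖u p q τ‖ ^ 2 := h4 _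
        _ ≤ K * (2 * ‖q - p‖) ^ 2 := by gcongr; exact hun p hp q τ hτ
        _ = _ := by ring
    have hosc : ∀ τ ∈ Icc (0 : ℝ) 1, ‖u p q τ - u p q t‖ ≤ 4 * K * ‖q - p‖ ^ 2 := by
      intro τ hτ
      refine ((convex_Icc (0 : ℝ) 1).norm_image_sub_le_of_norm_hasDerivWithin_le
        (fun y hy ↦ (hdu p q y hy).hasDerivWithinAt) hacc ht hτ).trans ?_
      refine mul_le_of_le_one_right (by positivity) ?_
      rw [Real.norm_eq_abs, abs_le]
      constructor <;> linarith [ht.1, ht.2, hτ.1, hτ.2]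
    -- Subtracting the straight motion with velocity `u p q t` leaves a curve whose derivative is
    -- small by `hosc`; its increment over `[0, 1]` is `q - p - u p q t`.
    have hd : ∀ τ ∈ Icc (0 : ℝ) 1, HasDerivWithinAt (fun τ ↦ c p q τ - τ • u p q t)
        (u p q τ - u p q t) (Icc (0 : ℝ) 1) τ := fun τ hτ ↦ by
      have h := (hdc p q τ).sub ((hasDerivAt_id τ).smul_const (u p q t))
      simpa only [one_smul] using! h.hasDerivWithinAt
    have := norm_image_sub_le_of_norm_deriv_le_segment_01' hd
      fun τ hτ ↦ hosc τ (Ico_subset_Icc_self hτ)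
    simp only [hc0, hc1, one_smul, zero_smul, sub_zero] at this
    rw [norm_sub_rev, show q - p - u p q t = q - u p q t - p by abel]
    refine this.trans ?_
    have : 0 ≤ K * ‖q - p‖ ^ 2 := by positivity
    linarith

end Geodesics

/-! ### First variation of the energy -/

section FirstVariation

variable {E : Type*} [NormedAddCommGroup E] [NormedSpace ℝ E]

set_option synthInstance.maxHeartbeats 200000

theorem hasDerivAt_form_apply {G : E → E →L[ℝ] E →L[ℝ] ℝ} {c v w : ℝ → E} {c' v' w' : E} {t : ℝ}
    (hG : DifferentiableAt ℝ G (c t)) (hc : HasDerivAt c c' t) (hv : HasDerivAt v v' t)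
    (hw : HasDerivAt w w' t) :
    HasDerivAt (fun t ↦ G (c t) (v t) (w t))
      (fderiv ℝ G (c t) c' (v t) (w t) + G (c t) v' (w t) + G (c t) (v t) w') t :=
  ((hG.hasFDerivAt.comp_hasDerivAt t hc).clm_apply hv).clm_apply hw

theorem hasFDerivAt_quadratic_apply {G : E → E →L[ℝ] E →L[ℝ] ℝ} {x v : E}
    (hG : DifferentiableAt ℝ G x) (hsymm : ∀ v w, G x v w = G x w v) (h k : E) :
    fderiv ℝ (fun z : E × E ↦ G z.1 z.2 z.2) (x, v) (h, k)
      = fderiv ℝ G x h v v + 2 * G x v k := by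
  have hd : DifferentiableAt ℝ (fun z : E × E ↦ G z.1 z.2 z.2) (x, v) := by
    have h1 : DifferentiableAt ℝ (fun z : E × E ↦ G z.1) (x, v) :=
      DifferentiableAt.comp (x, v) hG differentiableAt_fst
    exact (h1.clm_apply differentiableAt_snd).clm_apply differentiableAt_snd
  have hline : HasDerivAt (fun t : ℝ ↦ (x + t • h, v + t • k)) (h, k) 0 := by
    have h1 : HasDerivAt (fun t : ℝ ↦ x + t • h) h 0 := by
      simpa using ((hasDerivAt_id (0 : ℝ)).smul_const h).const_add x
    have h2 : HasDerivAt (fun t : ℝ ↦ v + t • k) k 0 := by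
      simpa using ((hasDerivAt_id (0 : ℝ)).smul_const k).const_add v
    exact h1.prodMk h2
  have e0 : (fun t : ℝ ↦ (x + t • h, v + t • k)) 0 = (x, v) := by simp
  rw [← e0] at hd
  have h1 := hd.hasFDerivAt.comp_hasDerivAt (0 : ℝ) hline
  have h2 : HasDerivAt (fun t : ℝ ↦ G (x + t • h) (v + t • k) (v + t • k)) _ 0 :=
    hasDerivAt_form_apply (G := G) (by simpa using hG) hline.fst hline.snd hline.snd
  rw [e0] at h1
  rw [h1.unique h2]
  simp only [zero_smul, add_zero, hsymm k v]
  ring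

/-- Quadratic Taylor estimate on a compact convex set. -/
theorem exists_norm_sub_sub_fderiv_le {F F' : Type*} [NormedAddCommGroup F] [NormedSpace ℝ F]
    [NormedAddCommGroup F'] [NormedSpace ℝ F'] {f : F → F'} {U s : Set F} (hU : IsOpen U)
    (hf : ContDiffOn ℝ 2 f U) (hs : IsCompact s) (hconv : Convex ℝ s) (hsU : s ⊆ U) :
    ∃ C : ℝ, 0 ≤ C ∧ ∀ x ∈ s, ∀ y ∈ s, ‖f y - f x - fderiv ℝ f x (y - x)‖ ≤ C * ‖y - x‖ ^ 2 := by
  obtain ⟨C, hC⟩ := ((hf.fderiv_of_isOpen (m := 1) hU (by norm_num)).mono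
    hsU).exists_lipschitzOnWith one_ne_zero hconv hs
  refine ⟨C, C.2, fun x hx y hy ↦ ?_⟩
  have hseg := hconv.segment_subset hx hy
  have := Convex.norm_image_sub_le_of_norm_hasFDerivWithin_le' (f := f) (f' := fderiv ℝ f)
    (s := segment ℝ x y) (φ := fderiv ℝ f x) (C := C * ‖y - x‖) (x := x) (y := y)
    (fun z hz ↦ ((hf.differentiableOn two_ne_zero).differentiableAt
      (hU.mem_nhds (hsU (hseg hz)))).hasFDerivAt.hasFDerivWithinAt)
    (fun z hz ↦ (hC.norm_sub_le (hseg hz) hx).trans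
      (mul_le_mul_of_nonneg_left (norm_sub_le_of_mem_segment hz) C.2))
    (convex_segment x y) (left_mem_segment ℝ x y) (right_mem_segment ℝ x y)
  rwa [mul_assoc, ← pow_two] at this

/-- A `C^2` Lorentzian metric and a continuous timelike vector field on a subset of a normed
space. -/
structure IsLorentzMetricOn (G : E → E →L[ℝ] E →L[ℝ] ℝ) (T : E → E) (W : Set E) : Prop where
  contDiffOn : ContDiffOn ℝ 2 G W
  isLorentzForm : ∀ x ∈ W, IsLorentzForm (G x)
  continuousOn : ContinuousOn T W
  timelike : ∀ x ∈ W, G x (T x) (T x) < 0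

theorem IsLorentzMetricOn.mono {G : E → E →L[ℝ] E →L[ℝ] ℝ} {T : E → E} {W W' : Set E}
    (h : IsLorentzMetricOn G T W) (hW : W' ⊆ W) : IsLorentzMetricOn G T W' :=
  ⟨h.contDiffOn.mono hW, fun x hx ↦ h.isLorentzForm x (hW hx), h.continuousOn.mono hW,
    fun x hx ↦ h.timelike x (hW hx)⟩

namespace GeodesicFamily

variable {G : E → E →L[ℝ] E →L[ℝ] ℝ} {T : E → E} {x₀ : E} {ρ : ℝ} (Γ : GeodesicFamily G x₀ ρ)

theorem norm_curve_sub_center_le {p q : E} (hp : p ∈ Metric.ball x₀ ρ) {t : ℝ}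
    (ht : t ∈ Icc (0 : ℝ) 1) : ‖Γ.curve p q t - x₀‖ ≤ 2 * (‖p - x₀‖ + ‖q - x₀‖) := by
  have := Γ.norm_curve_sub_le p q x₀ x₀ t ht
  rwa [Γ.curve_self x₀ (Metric.mem_ball_self (Metric.pos_of_mem_ball hp)) t ht] at this

theorem curve_mem_ball {r : ℝ} {p q : E} (hr : r ≤ ρ) (hp : p ∈ Metric.ball x₀ r)
    (hq : q ∈ Metric.ball x₀ r) {t : ℝ} (ht : t ∈ Icc (0 : ℝ) 1) :
    Γ.curve p q t ∈ Metric.ball x₀ (4 * r) := by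
  have := Γ.norm_curve_sub_center_le (q := q) (Metric.ball_subset_ball hr hp) ht
  rw [mem_ball_iff_norm] at *
  linarith

theorem norm_velocity_le {p q : E} (hp : p ∈ Metric.ball x₀ ρ) {t : ℝ} (ht : t ∈ Icc (0 : ℝ) 1) :
    ‖Γ.velocity p q t‖ ≤ 2 * ‖q - p‖ := by
  have := Γ.norm_velocity_sub_le p q p p t ht
  rwa [Γ.velocity_self p hp t ht, sub_zero, sub_self, norm_zero, zero_add] at this

/-- A vanishing velocity would give `‖q - p‖ ≤ bound * ‖q - p‖ ^ 2`, impossible since `‖q - p‖ ≤ 2 *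
ρ` and `bound * (2 * ρ) < 1`. -/
theorem velocity_ne_zero {p q : E} (hp : p ∈ Metric.ball x₀ ρ) (hq : q ∈ Metric.ball x₀ ρ)
    (hpq : p ≠ q) {t : ℝ} (ht : t ∈ Icc (0 : ℝ) 1) : Γ.velocity p q t ≠ 0 := by
  intro h0
  have h1 := Γ.norm_velocity_sub_sub_le p hp q hq t ht
  rw [h0, zero_sub, norm_neg] at h1
  have hpos : 0 < ‖q - p‖ := norm_pos_iff.2 (sub_ne_zero.2 hpq.symm)
  have h2 : 1 ≤ Γ.bound * ‖q - p‖ := by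
    by_contra! h
    have := mul_lt_mul_of_pos_right h hpos
    nlinarith
  have h3 : ‖q - p‖ ≤ 2 * ρ := by
    rw [mem_ball_iff_norm] at hp hq
    have : ‖q - p‖ ≤ ‖q - x₀‖ + ‖p - x₀‖ := by
      rw [← sub_sub_sub_cancel_right q p x₀]; exact norm_sub_le _ _
    linarith
  have hb : 0 < Γ.bound := by
    by_contra! h
    have := mul_nonpos_of_nonpos_of_nonneg h hpos.le
    linarith
  have := mul_le_mul_of_nonneg_left h3 hb.le
  linarith [Γ.bound_lt]

/-- Conservation of energy: testing the geodesic equation against the velocity itself cancels the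
derivative of the metric. -/
theorem energy_eq (hG : IsLorentzMetricOn G T (Metric.ball x₀ (4 * ρ))) {p q : E}
    (hp : p ∈ Metric.ball x₀ ρ) (hq : q ∈ Metric.ball x₀ ρ) {t : ℝ} (ht : t ∈ Icc (0 : ℝ) 1) :
    G (Γ.curve p q t) (Γ.velocity p q t) (Γ.velocity p q t)
      = G q (Γ.velocity p q 1) (Γ.velocity p q 1) := by
  have hd : ∀ s ∈ Icc (0 : ℝ) 1, HasDerivAt
      (fun s ↦ G (Γ.curve p q s) (Γ.velocity p q s) (Γ.velocity p q s)) 0 s := by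
    intro s hs
    have hmem := Γ.curve_mem_ball le_rfl hp hq hs
    have hu := Γ.hasDerivAt_velocity p hp q hq s hs
    have h := hasDerivAt_form_apply ((hG.contDiffOn.differentiableOn two_ne_zero).differentiableAt
      (Metric.isOpen_ball.mem_nhds hmem)) (Γ.hasDerivAt_curve p q s) hu hu
    convert h using 1
    rw [(hG.isLorentzForm _ hmem).symm (Γ.velocity p q s), Γ.geodesic p hp q hq s hs,
      geodesicForce_apply]
    ring
  have hc := constant_of_has_deriv_right_zero
    (fun s hs ↦ (hd s hs).continuousAt.continuousWithinAt)
    (fun s hs ↦ (hd s (Ico_subset_Icc_self hs)).hasDerivWithinAt)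
  have := (hc t ht).trans (hc 1 (right_mem_Icc.2 zero_le_one)).symm
  simpa only [Γ.curve_one] using this

variable [FiniteDimensional ℝ E]

/-- The first variation of the energy of the geodesic from `p` to `q` with respect to `q`. -/
theorem hasFDerivAt_energy (hG : IsLorentzMetricOn G T (Metric.ball x₀ (4 * ρ))) {p q : E}
    (hp : p ∈ Metric.ball x₀ ρ) (hq : q ∈ Metric.ball x₀ ρ) :
    HasFDerivAt (fun q ↦ G q (Γ.velocity p q 1) (Γ.velocity p q 1))
      ((2 : ℝ) • G q (Γ.velocity p q 1)) q := by
  have hρ := Metric.pos_of_mem_ball hp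
  -- `r` bounds the distance from `x₀` of every geodesic starting at `p`, and is strictly below `4 *
  -- ρ`, so the closed ball is a compact set on which the Taylor constant is uniform.
  set r := 2 * ‖p - x₀‖ + 2 * ρ with hr
  have hrρ : r < 4 * ρ := by rw [mem_ball_iff_norm] at hp; linarith
  have hL : ContDiffOn ℝ 2 (fun z : E × E ↦ G z.1 z.2 z.2)
      (Metric.ball x₀ (4 * ρ) ×ˢ (univ : Set E)) := by
    have h1 : ContDiffOn ℝ 2 (fun z : E × E ↦ G z.1) (Metric.ball x₀ (4 * ρ) ×ˢ (univ : Set E)) :=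
      hG.contDiffOn.comp contDiffOn_fst fun z hz ↦ hz.1
    exact (h1.clm_apply contDiffOn_snd).clm_apply contDiffOn_snd
  obtain ⟨C, hC0, hC⟩ := exists_norm_sub_sub_fderiv_le
    (s := Metric.closedBall x₀ r ×ˢ Metric.closedBall (0 : E) (4 * ρ))
    (Metric.isOpen_ball.prod isOpen_univ) hL
    ((isCompact_closedBall _ _).prod (isCompact_closedBall _ _))
    ((convex_closedBall _ _).prod (convex_closedBall _ _))
    (prod_mono (Metric.closedBall_subset_ball hrρ) (subset_univ _))
  have hmem : ∀ q ∈ Metric.ball x₀ ρ, ∀ t ∈ Icc (0 : ℝ) 1, (Γ.curve p q t, Γ.velocity p q t) ∈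
      Metric.closedBall x₀ r ×ˢ Metric.closedBall (0 : E) (4 * ρ) := by
    intro q hq t ht
    rw [mem_prod, mem_closedBall_iff_norm, mem_closedBall_zero_iff]
    have h1 := Γ.norm_curve_sub_center_le (q := q) hp ht
    have h2 := Γ.norm_velocity_le (q := q) hp ht
    rw [mem_ball_iff_norm] at hp hq
    have : ‖q - p‖ ≤ ‖q - x₀‖ + ‖p - x₀‖ := by
      rw [← sub_sub_sub_cancel_right q p x₀]; exact norm_sub_le _ _
    constructor <;> simp only <;> linarith
  -- Lipschitz dependence of the geodesics on `q` suffices: they are never differentiated in `q`,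
  -- and the Taylor remainder of the Lagrangian is already quadratic in `q' - q`.
  have key : ∀ q' ∈ Metric.ball x₀ ρ,
      ‖G q' (Γ.velocity p q' 1) (Γ.velocity p q' 1) - G q (Γ.velocity p q 1) (Γ.velocity p q 1)
        - ((2 : ℝ) • G q (Γ.velocity p q 1)) (q' - q)‖ ≤ 4 * C * ‖q' - q‖ ^ 2 := by
    intro q' hq'
    set Δ := G q' (Γ.velocity p q' 1) (Γ.velocity p q' 1)
      - G q (Γ.velocity p q 1) (Γ.velocity p q 1) with hΔ
    let h : ℝ → E := fun t ↦ Γ.curve p q' t - Γ.curve p q t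
    let k : ℝ → E := fun t ↦ Γ.velocity p q' t - Γ.velocity p q t
    -- By the Euler–Lagrange equation, `G(u, h)` has derivative half the linearised change of the
    -- Lagrangian. By energy conservation the true change is the constant `Δ`.
    have hd : ∀ t ∈ Icc (0 : ℝ) 1, HasDerivWithinAt
        (fun t ↦ G (Γ.curve p q t) (Γ.velocity p q t) (h t) - t * (Δ / 2))
        (1 / 2 * (fderiv ℝ (fun z : E × E ↦ G z.1 z.2 z.2) (Γ.curve p q t, Γ.velocity p q t)
          (h t, k t) - Δ)) (Icc (0 : ℝ) 1) t := by
      intro t ht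
      have hm := Γ.curve_mem_ball le_rfl hp hq ht
      have hGd := (hG.contDiffOn.differentiableOn two_ne_zero).differentiableAt
        (Metric.isOpen_ball.mem_nhds hm)
      have h1 := hasDerivAt_form_apply hGd (Γ.hasDerivAt_curve p q t)
        (Γ.hasDerivAt_velocity p hp q hq t ht)
        ((Γ.hasDerivAt_curve p q' t).sub (Γ.hasDerivAt_curve p q t))
      have h2 := h1.sub ((hasDerivAt_id t).mul_const (Δ / 2))
      refine HasDerivAt.hasDerivWithinAt ?_
      convert! h2 using 1
      rw [hasFDerivAt_quadratic_apply hGd (hG.isLorentzForm _ hm).symm,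
        Γ.geodesic p hp q hq t ht, geodesicForce_apply]
      simp only [h, k, Pi.sub_apply]
      ring
    have hb : ∀ t ∈ Ico (0 : ℝ) 1,
        ‖1 / 2 * (fderiv ℝ (fun z : E × E ↦ G z.1 z.2 z.2) (Γ.curve p q t, Γ.velocity p q t)
          (h t, k t) - Δ)‖ ≤ 2 * C * ‖q' - q‖ ^ 2 := by
      intro t ht'
      have ht := Ico_subset_Icc_self ht'
      have h1 := hC _ (hmem q hq t ht) _ (hmem q' hq' t ht)
      simp only [Γ.energy_eq hG hp hq ht, Γ.energy_eq hG hp hq' ht, Prod.mk_sub_mk] at h1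
      have h2 : ‖(h t, k t)‖ ≤ 2 * ‖q' - q‖ := by
        rw [Prod.norm_mk]
        have a1 := Γ.norm_curve_sub_le p q' p q t ht
        have a2 := Γ.norm_velocity_sub_le p q' p q t ht
        rw [sub_self, norm_zero, zero_add] at a1 a2
        exact max_le a1 a2
      have h3 : C * ‖(h t, k t)‖ ^ 2 ≤ C * (2 * ‖q' - q‖) ^ 2 := by gcongr
      rw [norm_mul, show ‖(1 / 2 : ℝ)‖ = 1 / 2 by norm_num, norm_sub_rev]
      have h4 := h1.trans h3
      simp only [h, k, ← hΔ] at h4 ⊢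
      linarith
    -- At the ends of the interval `h` is `0` and `q' - q`, so integration isolates the boundary
    -- term.
    have := norm_image_sub_le_of_norm_deriv_le_segment_01' hd hb
    simp only [h, Γ.curve_one, Γ.curve_zero, sub_self, map_zero, one_mul, zero_mul,
      sub_zero] at this
    have e : Δ - ((2 : ℝ) • G q (Γ.velocity p q 1)) (q' - q)
        = -2 * (G q (Γ.velocity p q 1) (q' - q) - Δ / 2) := by
      rw [smul_apply, smul_eq_mul]; ring
    rw [e, norm_mul, show ‖(-2 : ℝ)‖ = 2 by norm_num]
    linarith
  have h0 : HasFDerivAt (fun q' ↦ G q' (Γ.velocity p q' 1) (Γ.velocity p q' 1)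
      - G q (Γ.velocity p q 1) (Γ.velocity p q 1)
      - ((2 : ℝ) • G q (Γ.velocity p q 1)) (q' - q)) (0 : E →L[ℝ] ℝ) q := by
    refine Asymptotics.IsBigO.hasFDerivAt (n := 2) (.of_bound (4 * C) ?_) one_lt_two
    filter_upwards [Metric.isOpen_ball.mem_nhds hq] with q' hq'
    rw [norm_pow, norm_norm]
    exact key q' hq'
  have h1 : HasFDerivAt (fun q' ↦ ((2 : ℝ) • G q (Γ.velocity p q 1)) (q' - q))
      ((2 : ℝ) • G q (Γ.velocity p q 1)) q :=
    ((2 : ℝ) • G q (Γ.velocity p q 1)).hasFDerivAt.comp q ((hasFDerivAt_id q).sub_const q)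
  have h2 := (h0.add h1).add_const (G q (Γ.velocity p q 1) (Γ.velocity p q 1))
  rw [zero_add] at h2
  refine h2.congr_of_eventuallyEq (.of_forall fun q' ↦ ?_)
  simp only [Pi.add_apply]
  ring

end GeodesicFamily

end FirstVariation

/-! ### Causality inside a geodesic ball -/

section LocalCausality

variable {E : Type*} [NormedAddCommGroup E]

theorem mem_ball_four_mul {x₀ : E} {ρ : ℝ} {q : E} (hq : q ∈ Metric.ball x₀ ρ) :
    q ∈ Metric.ball x₀ (4 * ρ) :=
  Metric.ball_subset_ball (by linarith [Metric.pos_of_mem_ball hq]) hq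

variable [NormedSpace ℝ E]

set_option synthInstance.maxHeartbeats 200000

namespace GeodesicFamily

open Filter

variable {G : E → E →L[ℝ] E →L[ℝ] ℝ} {T : E → E} {x₀ : E} {ρ : ℝ} (Γ : GeodesicFamily G x₀ ρ)

/-- The geodesic from `p` to `q` arrives with a future-directed timelike velocity. -/
def IsTimelike (T : E → E) (p q : E) : Prop :=
  G q (Γ.velocity p q 1) (Γ.velocity p q 1) < 0 ∧ G q (T q) (Γ.velocity p q 1) < 0

/-- The geodesic from `p` to `q` arrives with a future-directed causal velocity. -/
def IsCausal (T : E → E) (p q : E) : Prop :=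
  G q (Γ.velocity p q 1) (Γ.velocity p q 1) ≤ 0 ∧ G q (T q) (Γ.velocity p q 1) < 0

theorem continuous_velocity_one : Continuous fun z : E × E ↦ Γ.velocity z.1 z.2 1 := by
  refine LipschitzWith.continuous (K := 4) (LipschitzWith.of_dist_le_mul fun z z' ↦ ?_)
  rw [dist_eq_norm, dist_eq_norm]
  have h := Γ.norm_velocity_sub_le z.1 z.2 z'.1 z'.2 1 (right_mem_Icc.2 zero_le_one)
  have h1 := norm_fst_le (z - z')
  have h2 := norm_snd_le (z - z')
  rw [Prod.fst_sub] at h1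
  rw [Prod.snd_sub] at h2
  have : ((4 : NNReal) : ℝ) = 4 := by norm_num
  rw [this]
  linarith

theorem tendsto_velocity_one {ι : Type*} {l : Filter ι} {P Q : ι → E} {p q : E}
    (hP : Tendsto P l (𝓝 p)) (hQ : Tendsto Q l (𝓝 q)) :
    Tendsto (fun i ↦ Γ.velocity (P i) (Q i) 1) l (𝓝 (Γ.velocity p q 1)) :=
  (Γ.continuous_velocity_one.tendsto (p, q)).comp (hP.prodMk_nhds hQ)

theorem tendsto_form_apply {ι : Type*} {l : Filter ι} {Q v w : ι → E} {q a b : E}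
    (hG : ContinuousAt G q) (hQ : Tendsto Q l (𝓝 q)) (hv : Tendsto v l (𝓝 a))
    (hw : Tendsto w l (𝓝 b)) : Tendsto (fun i ↦ G (Q i) (v i) (w i)) l (𝓝 (G q a b)) := by
  have h1 : Tendsto (fun i ↦ G (Q i) (v i)) l (𝓝 (G q a)) :=
    (isBoundedBilinearMap_apply.continuous.tendsto (G q, a)).comp
      ((hG.tendsto.comp hQ).prodMk_nhds hv)
  exact (isBoundedBilinearMap_apply.continuous.tendsto (G q a, b)).comp (h1.prodMk_nhds hw)

variable {Γ}

theorem IsTimelike.isCausal {p q : E} (h : Γ.IsTimelike T p q) : Γ.IsCausal T p q :=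
  ⟨h.1.le, h.2⟩

theorem continuousAt_metric (hG : IsLorentzMetricOn G T (Metric.ball x₀ (4 * ρ)))
    {q : E} (hq : q ∈ Metric.ball x₀ (4 * ρ)) : ContinuousAt G q :=
  hG.contDiffOn.continuousOn.continuousAt (Metric.isOpen_ball.mem_nhds hq)

theorem continuousAt_time (hG : IsLorentzMetricOn G T (Metric.ball x₀ (4 * ρ)))
    {q : E} (hq : q ∈ Metric.ball x₀ (4 * ρ)) : ContinuousAt T q :=
  hG.continuousOn.continuousAt (Metric.isOpen_ball.mem_nhds hq)

theorem IsTimelike.eventually (hG : IsLorentzMetricOn G T (Metric.ball x₀ (4 * ρ)))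
    {p q : E} (h : Γ.IsTimelike T p q) (hq : q ∈ Metric.ball x₀ ρ)
    {ι : Type*} {l : Filter ι} {P Q : ι → E} (hP : Tendsto P l (𝓝 p)) (hQ : Tendsto Q l (𝓝 q)) :
    ∀ᶠ i in l, Γ.IsTimelike T (P i) (Q i) := by
  have hq' := mem_ball_four_mul hq
  have hu := Γ.tendsto_velocity_one hP hQ
  have hc := continuousAt_metric hG hq'
  exact ((tendsto_form_apply hc hQ hu hu).eventually_lt_const h.1).and
    ((tendsto_form_apply hc hQ ((continuousAt_time hG hq').tendsto.comp hQ) hu).eventually_lt_const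
      h.2)

/-- Limits weaken both inequalities, but the second stays strict: for `p ≠ q` the arrival velocity
is a nonzero causal vector, which is not orthogonal to `T`. -/
theorem isCausal_of_tendsto (hG : IsLorentzMetricOn G T (Metric.ball x₀ (4 * ρ)))
    {p q : E} (hp : p ∈ Metric.ball x₀ ρ) (hq : q ∈ Metric.ball x₀ ρ)
    (hpq : p ≠ q) {ι : Type*} {l : Filter ι} [l.NeBot] {P Q : ι → E} (hP : Tendsto P l (𝓝 p))
    (hQ : Tendsto Q l (𝓝 q)) (h : ∀ᶠ i in l, Γ.IsTimelike T (P i) (Q i)) : Γ.IsCausal T p q := by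
  have hq' := mem_ball_four_mul hq
  have hu := Γ.tendsto_velocity_one hP hQ
  have hc := continuousAt_metric hG hq'
  have h1 : G q (Γ.velocity p q 1) (Γ.velocity p q 1) ≤ 0 :=
    le_of_tendsto (tendsto_form_apply hc hQ hu hu) (h.mono fun i hi ↦ hi.1.le)
  have h2 : G q (T q) (Γ.velocity p q 1) ≤ 0 :=
    le_of_tendsto (tendsto_form_apply hc hQ ((continuousAt_time hG hq').tendsto.comp hQ) hu)
      (h.mono fun i hi ↦ hi.2.le)
  exact ⟨h1, h2.lt_of_ne ((hG.isLorentzForm q hq').ne_zero_of_causal (hG.timelike q hq') h1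
    (Γ.velocity_ne_zero hp hq hpq (right_mem_Icc.2 zero_le_one)))⟩

/-- A geodesic which arrives causally is causal and future-directed throughout. -/
theorem IsCausal.velocity_future (hG : IsLorentzMetricOn G T (Metric.ball x₀ (4 * ρ)))
    {p q : E} (h : Γ.IsCausal T p q) (hp : p ∈ Metric.ball x₀ ρ)
    (hq : q ∈ Metric.ball x₀ ρ) (hpq : p ≠ q) {t : ℝ} (ht : t ∈ Icc (0 : ℝ) 1) :
    G (Γ.curve p q t) (Γ.velocity p q t) (Γ.velocity p q t) ≤ 0 ∧
      G (Γ.curve p q t) (T (Γ.curve p q t)) (Γ.velocity p q t) < 0 := by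
  have hE : ∀ s ∈ Icc (0 : ℝ) 1,
      G (Γ.curve p q s) (Γ.velocity p q s) (Γ.velocity p q s) ≤ 0 := fun s hs ↦ by
    rw [Γ.energy_eq hG hp hq hs]; exact h.1
  have hm : ∀ s ∈ Icc (0 : ℝ) 1, Γ.curve p q s ∈ Metric.ball x₀ (4 * ρ) := fun s hs ↦
    Γ.curve_mem_ball le_rfl hp hq hs
  have hne : ∀ s ∈ Icc (0 : ℝ) 1,
      G (Γ.curve p q s) (T (Γ.curve p q s)) (Γ.velocity p q s) ≠ 0 := fun s hs ↦
    (hG.isLorentzForm _ (hm s hs)).ne_zero_of_causal (hG.timelike _ (hm s hs)) (hE s hs)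
      (Γ.velocity_ne_zero hp hq hpq hs)
  have hcont : ContinuousOn
      (fun s ↦ G (Γ.curve p q s) (T (Γ.curve p q s)) (Γ.velocity p q s)) (Icc (0 : ℝ) 1) := by
    intro s hs
    have hc := (Γ.hasDerivAt_curve p q s).continuousAt
    refine ContinuousAt.continuousWithinAt ?_
    exact tendsto_form_apply (continuousAt_metric hG (hm s hs)) hc
      ((continuousAt_time hG (hm s hs)).tendsto.comp hc) (Γ.continuous_velocity p q).continuousAt
  refine ⟨hE t ht, ?_⟩
  by_contra! hpos
  -- The product with `T` is negative at time `1` and never vanishes on causal velocities, so it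
  -- cannot change sign.
  obtain ⟨s, hs, hs0⟩ := intermediate_value_Icc' ht.2
    (hcont.mono (Icc_subset_Icc_left ht.1)) (show (0 : ℝ) ∈ Icc _ _ from
      ⟨by simpa only [Γ.curve_one] using h.2.le, hpos⟩)
  exact hne s ⟨ht.1.trans hs.1, hs.2⟩ hs0

theorem IsTimelike.ne {p q : E} (h : Γ.IsTimelike T p q) (hp : p ∈ Metric.ball x₀ ρ) : p ≠ q := by
  rintro rfl
  have := h.1
  rw [Γ.velocity_self p hp 1 (right_mem_Icc.2 zero_le_one)] at this
  simp at this

theorem IsTimelike.velocity_future (hG : IsLorentzMetricOn G T (Metric.ball x₀ (4 * ρ)))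
    {p q : E} (h : Γ.IsTimelike T p q) (hp : p ∈ Metric.ball x₀ ρ)
    (hq : q ∈ Metric.ball x₀ ρ) {t : ℝ} (ht : t ∈ Icc (0 : ℝ) 1) :
    G (Γ.curve p q t) (Γ.velocity p q t) (Γ.velocity p q t) < 0 ∧
      G (Γ.curve p q t) (T (Γ.curve p q t)) (Γ.velocity p q t) < 0 := by
  refine ⟨?_, (h.isCausal.velocity_future hG hp hq (h.ne hp) ht).2⟩
  rw [Γ.energy_eq hG hp hq ht]
  exact h.1

/-- Points which separate in a future-directed timelike direction are joined by future-directed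
timelike geodesics. -/
theorem eventually_isTimelike (hG : IsLorentzMetricOn G T (Metric.ball x₀ (4 * ρ)))
    {p v : E} (hp : p ∈ Metric.ball x₀ ρ) (hv : G p v v < 0)
    (hTv : G p (T p) v < 0) {ι : Type*} {l : Filter ι} {P Q : ι → E} {ε : ι → ℝ}
    (hP : Tendsto P l (𝓝 p)) (hQ : Tendsto Q l (𝓝 p)) (hε : ∀ᶠ i in l, 0 < ε i)
    (hPQ : Tendsto (fun i ↦ (ε i)⁻¹ • (Q i - P i)) l (𝓝 v)) :
    ∀ᶠ i in l, Γ.IsTimelike T (P i) (Q i) := by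
  have hp' := mem_ball_four_mul hp
  -- Arrival velocity and chord differ by a term quadratic in the chord, which vanishes after
  -- rescaling by `ε`.
  have hz : Tendsto (fun i ↦ (ε i)⁻¹ • (Γ.velocity (P i) (Q i) 1 - (Q i - P i))) l (𝓝 0) := by
    have h0 : Tendsto (fun i ↦ Γ.bound * ‖Q i - P i‖ * ‖(ε i)⁻¹ • (Q i - P i)‖) l (𝓝 0) := by
      have := ((hQ.sub hP).norm.const_mul Γ.bound).mul hPQ.norm
      simpa using this
    refine squeeze_zero_norm' ?_ h0
    filter_upwards [hε, hP.eventually (Metric.isOpen_ball.mem_nhds hp),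
      hQ.eventually (Metric.isOpen_ball.mem_nhds hp)] with i hi hPi hQi
    rw [norm_smul, norm_smul]
    have := Γ.norm_velocity_sub_sub_le _ hPi _ hQi 1 (right_mem_Icc.2 zero_le_one)
    calc _ ≤ ‖(ε i)⁻¹‖ * (Γ.bound * ‖Q i - P i‖ ^ 2) :=
          mul_le_mul_of_nonneg_left this (norm_nonneg _)
      _ = _ := by ring
  have hu : Tendsto (fun i ↦ (ε i)⁻¹ • Γ.velocity (P i) (Q i) 1) l (𝓝 v) := by
    have := hz.add hPQ
    rw [zero_add] at this
    refine this.congr fun i ↦ ?_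
    rw [← smul_add, sub_add_cancel]
  have hc := continuousAt_metric hG hp'
  filter_upwards [hε, (tendsto_form_apply hc hQ hu hu).eventually_lt_const hv,
    (tendsto_form_apply hc hQ ((continuousAt_time hG hp').tendsto.comp hQ) hu).eventually_lt_const
      hTv] with i hi h1 h2
  have hi' : 0 < (ε i)⁻¹ := inv_pos.2 hi
  simp only [map_smul, smul_apply, smul_eq_mul, Function.comp_apply] at h1 h2
  exact ⟨neg_of_mul_neg_right (neg_of_mul_neg_right h1 hi'.le) hi'.le,
    neg_of_mul_neg_right h2 hi'.le⟩

variable [FiniteDimensional ℝ E]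

/-- If `α a` is timelike related to `p`, then so is the endpoint of each future-directed causal
curve starting from `α a`. -/
theorem IsTimelike.of_causal_curve (hG : IsLorentzMetricOn G T (Metric.ball x₀ (4 * ρ)))
    {p : E} {α α' : ℝ → E} {a b : ℝ} (hab : a ≤ b)
    (hp : p ∈ Metric.ball x₀ ρ) (hmem : ∀ s ∈ Icc a b, α s ∈ Metric.ball x₀ ρ)
    (hα : ∀ s ∈ Icc a b, HasDerivWithinAt α (α' s) (Icc a b) s)
    (hcausal : ∀ s ∈ Icc a b, G (α s) (α' s) (α' s) ≤ 0)
    (hfuture : ∀ s ∈ Icc a b, G (α s) (T (α s)) (α' s) < 0)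
    (h : Γ.IsTimelike T p (α a)) : Γ.IsTimelike T p (α b) := by
  let σ : ℝ → ℝ := fun s ↦ G (α s) (Γ.velocity p (α s) 1) (Γ.velocity p (α s) 1)
  let τ : ℝ → ℝ := fun s ↦ G (α s) (T (α s)) (Γ.velocity p (α s) 1)
  have hαc : ContinuousOn α (Icc a b) := fun s hs ↦ (hα s hs).continuousWithinAt
  have hσd : ∀ s ∈ Icc a b,
      HasDerivWithinAt σ (2 * G (α s) (Γ.velocity p (α s) 1) (α' s)) (Icc a b) s := fun s hs ↦
    (Γ.hasFDerivAt_energy hG hp (hmem s hs)).comp_hasDerivWithinAt s (hα s hs)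
  have hσc : ContinuousOn σ (Icc a b) := fun s hs ↦ (hσd s hs).continuousWithinAt
  have hτc : ContinuousOn τ (Icc a b) := fun s hs ↦ by
    have hm := mem_ball_four_mul (hmem s hs)
    exact tendsto_form_apply (continuousAt_metric hG hm) (hαc s hs)
      ((continuousAt_time hG hm).tendsto.comp (hαc s hs))
      (Γ.tendsto_velocity_one tendsto_const_nhds (hαc s hs))
  -- The weak inequalities define a closed set, yet imply the strict ones: `σ s ≤ σ a < 0`, and then
  -- `τ s = 0` is excluded.
  have hgood : ∀ s ∈ Icc a b, σ s ≤ σ a → τ s ≤ 0 → Γ.IsTimelike T p (α s) := by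
    intro s hs h1 h2
    have h3 : σ s < 0 := h1.trans_lt h.1
    refine ⟨h3, h2.lt_of_ne fun h0 ↦ ?_⟩
    have hm := mem_ball_four_mul (hmem s hs)
    refine (hG.isLorentzForm _ hm).ne_zero_of_causal (hG.timelike _ hm) h3.le (fun hv ↦ ?_) h0
    simp [σ, hv] at h3
  have hclosed : IsClosed ({s | σ s ≤ σ a ∧ τ s ≤ 0} ∩ Icc a b) := by
    have h1 := hσc.preimage_isClosed_of_isClosed isClosed_Icc (isClosed_Iic (a := σ a))
    have h2 := hτc.preimage_isClosed_of_isClosed isClosed_Icc (isClosed_Iic (a := 0))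
    convert h1.inter h2 using 1
    ext s
    simp only [mem_inter_iff, mem_ofPred_eq, mem_preimage, mem_Iic]
    tauto
  -- Continuous induction on the interval: at a good point `σ` has negative derivative by the first
  -- variation and `τ` is negative, so good points continue to the right.
  have hall := hclosed.Icc_subset_of_forall_exists_gt ⟨le_rfl, h.2.le⟩ (by
    rintro s ⟨⟨hs1, hs2⟩, hs⟩ y hy
    have hs' := Ico_subset_Icc_self hs
    have hsg := hgood s hs' hs1 hs2
    have hm := mem_ball_four_mul (hmem s hs')
    have hneg : 2 * G (α s) (Γ.velocity p (α s) 1) (α' s) < 0 := by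
      have := (hG.isLorentzForm _ hm).apply_neg_of_future (hG.timelike _ hm) hsg.1 hsg.2
        (hcausal s hs') (hfuture s hs')
      linarith
    have hsub : Ioc s b ⊆ Icc a b := fun z hz ↦ ⟨hs.1.trans hz.1.le, hz.2⟩
    have hnhds : 𝓝[>] s ≤ 𝓝[Icc a b] s := by
      rw [← nhdsWithin_Ioc_eq_nhdsGT hs.2]
      exact nhdsWithin_mono _ hsub
    have hd : HasDerivWithinAt σ (2 * G (α s) (Γ.velocity p (α s) 1) (α' s)) (Ioi s) s :=
      (hσd s hs').mono_of_mem_nhdsWithin (hnhds self_mem_nhdsWithin)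
    have e1 : ∀ᶠ z in 𝓝[>] s, slope σ s z < 0 :=
      ((hasDerivWithinAt_iff_tendsto_slope' (by simp)).1 hd).eventually_lt_const hneg
    have e2 : ∀ᶠ z in 𝓝[>] s, τ z < 0 :=
      ((hτc s hs').mono_left hnhds).eventually_lt_const hsg.2
    obtain ⟨z, hz1, hz2, hz3⟩ := (e1.and (e2.and (Ioc_mem_nhdsGT hy))).exists
    refine ⟨z, ⟨?_, hz2.le⟩, hz3⟩
    rw [slope_def_field, div_neg_iff] at hz1
    rcases hz1 with h | h <;> linarith [hz3.1])
  obtain ⟨h1, h2⟩ := hall (right_mem_Icc.2 hab)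
  exact hgood b (right_mem_Icc.2 hab) h1 h2

/-- The endpoint of a future-directed timelike curve is timelike related to its origin. -/
theorem isTimelike_of_timelike_curve (hG : IsLorentzMetricOn G T (Metric.ball x₀ (4 * ρ)))
    {α α' : ℝ → E} {a b : ℝ} (hab : a < b)
    (hmem : ∀ s ∈ Icc a b, α s ∈ Metric.ball x₀ ρ)
    (hα : ∀ s ∈ Icc a b, HasDerivWithinAt α (α' s) (Icc a b) s)
    (htimelike : ∀ s ∈ Icc a b, G (α s) (α' s) (α' s) < 0)
    (hfuture : ∀ s ∈ Icc a b, G (α s) (T (α s)) (α' s) < 0) : Γ.IsTimelike T (α a) (α b) := by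
  have ha := left_mem_Icc.2 hab.le
  have hd : HasDerivWithinAt α (α' a) (Ioi a) a :=
    (hα a ha).mono_of_mem_nhdsWithin (mem_of_superset (Ioc_mem_nhdsGT hab) Ioc_subset_Icc_self)
  -- At `a` itself the geodesic is constant and not timelike; difference quotients tending to `α' a`
  -- provide a first timelike related point just after `a`.
  have hev := eventually_isTimelike (Γ := Γ) hG (hmem a ha) (htimelike a ha) (hfuture a ha)
    (P := fun _ ↦ α a) (ε := fun s ↦ s - a) tendsto_const_nhds hd.continuousWithinAt
    (by filter_upwards [self_mem_nhdsWithin] with s hs using sub_pos.2 hs)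
    ((hasDerivWithinAt_iff_tendsto_slope' (by simp)).1 hd)
  obtain ⟨s, hs, hsab⟩ := (hev.and (Ioc_mem_nhdsGT hab)).exists
  have hsub : Icc s b ⊆ Icc a b := Icc_subset_Icc_left hsab.1.le
  exact hs.of_causal_curve hG hsab.2 (hmem a ha) (fun r hr ↦ hmem r (hsub hr))
    (fun r hr ↦ (hα r (hsub hr)).mono hsub) (fun r hr ↦ (htimelike r (hsub hr)).le)
    (fun r hr ↦ hfuture r (hsub hr))

/-- The push-up property along causal geodesics. -/
theorem IsTimelike.trans_isCausal (hG : IsLorentzMetricOn G T (Metric.ball x₀ (4 * ρ)))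
    {o p q : E} (h : Γ.IsTimelike T o p) (hpq : Γ.IsCausal T p q)
    (ho : o ∈ Metric.ball x₀ ρ) (hp : p ∈ Metric.ball x₀ (ρ / 4))
    (hq : q ∈ Metric.ball x₀ (ρ / 4)) (hne : p ≠ q) : Γ.IsTimelike T o q := by
  have hρ := Metric.pos_of_mem_ball ho
  have hle : ρ / 4 ≤ ρ := by linarith
  have hp' := Metric.ball_subset_ball hle hp
  have hq' := Metric.ball_subset_ball hle hq
  have h01 := left_mem_Icc.2 (zero_le_one' ℝ)
  have hmem : ∀ s ∈ Icc (0 : ℝ) 1, Γ.curve p q s ∈ Metric.ball x₀ ρ := fun s hs ↦ by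
    have := Γ.curve_mem_ball hle hp hq hs
    rwa [mul_div_cancel₀ ρ four_ne_zero] at this
  have h0 : Γ.IsTimelike T o (Γ.curve p q 0) := by rwa [Γ.curve_zero]
  have := h0.of_causal_curve hG zero_le_one ho hmem
    (fun s _ ↦ (Γ.hasDerivAt_curve p q s).hasDerivWithinAt)
    (fun s hs ↦ (hpq.velocity_future hG hp' hq' hne hs).1)
    (fun s hs ↦ (hpq.velocity_future hG hp' hq' hne hs).2)
  rwa [Γ.curve_one] at this

end GeodesicFamily

end LocalCausality

/-! ### The metric and the time orientation in a chart -/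

namespace Spacetime

variable {n : ℕ} {r : ℕ∞} {M : Type*} [TopologicalSpace M]
  [ChartedSpace (EuclideanSpace ℝ (Fin n)) M] [IsManifold (𝓡 n) 1 M]

/-- The representation of tangent vectors at `y` in the chart about `x₀`. -/
noncomputable def toChart (x₀ y : M) : TangentSpace (𝓡 n) y →L[ℝ] EuclideanSpace ℝ (Fin n) :=
  (trivializationAt (EuclideanSpace ℝ (Fin n)) (TangentSpace (𝓡 n)) x₀).continuousLinearMapAt ℝ y

/-- The tangent vector at `y` with a given representation in the chart about `x₀`. -/
noncomputable def ofChart (x₀ y : M) : EuclideanSpace ℝ (Fin n) →L[ℝ] TangentSpace (𝓡 n) y :=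
  (trivializationAt (EuclideanSpace ℝ (Fin n)) (TangentSpace (𝓡 n)) x₀).symmL ℝ y

theorem ofChart_toChart {x₀ y : M} (hy : y ∈ (extChartAt (𝓡 n) x₀).source)
    (v : TangentSpace (𝓡 n) y) : ofChart x₀ y (toChart x₀ y v) = v :=
  Bundle.Trivialization.symmL_continuousLinearMapAt _ (by simpa using hy) v

theorem toChart_ofChart {x₀ y : M} (hy : y ∈ (extChartAt (𝓡 n) x₀).source)
    (v : EuclideanSpace ℝ (Fin n)) : toChart x₀ y (ofChart x₀ y v) = v :=
  Bundle.Trivialization.continuousLinearMapAt_symmL _ (by simpa using hy) v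

theorem toChart_eq_mfderiv {x₀ y : M} (hy : y ∈ (extChartAt (𝓡 n) x₀).source) :
    toChart x₀ y = mfderiv (𝓡 n) 𝓘(ℝ, EuclideanSpace ℝ (Fin n)) (extChartAt (𝓡 n) x₀) y :=
  TangentBundle.continuousLinearMapAt_trivializationAt (by simpa using hy)

/-- The metric at `y` in the chart about `x₀`. -/
noncomputable def metricInChart (S : Spacetime n r M) (x₀ y : M) :
    EuclideanSpace ℝ (Fin n) →L[ℝ] EuclideanSpace ℝ (Fin n) →L[ℝ] ℝ :=
  ((ofChart x₀ y).precomp ℝ ∘L S.metric y) ∘L ofChart x₀ y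

theorem metricInChart_apply (S : Spacetime n r M) (x₀ y : M) (v w : EuclideanSpace ℝ (Fin n)) :
    S.metricInChart x₀ y v w = S.metric y (ofChart x₀ y v) (ofChart x₀ y w) := rfl

/-- The metric in the chart about `x₀`, as a function of the coordinates. -/
noncomputable def chartMetric (S : Spacetime n r M) (x₀ : M) (z : EuclideanSpace ℝ (Fin n)) :
    EuclideanSpace ℝ (Fin n) →L[ℝ] EuclideanSpace ℝ (Fin n) →L[ℝ] ℝ :=
  S.metricInChart x₀ ((extChartAt (𝓡 n) x₀).symm z)

/-- The time orientation in the chart about `x₀`, as a function of the coordinates. -/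
noncomputable def chartTime (S : Spacetime n r M) (x₀ : M) (z : EuclideanSpace ℝ (Fin n)) :
    EuclideanSpace ℝ (Fin n) :=
  toChart x₀ _ (S.timeField ((extChartAt (𝓡 n) x₀).symm z))

variable {S : Spacetime n r M} {x₀ y : M}

theorem metricInChart_toChart (hy : y ∈ (extChartAt (𝓡 n) x₀).source)
    (v w : TangentSpace (𝓡 n) y) :
    S.metricInChart x₀ y (toChart x₀ y v) (toChart x₀ y w) = S.metric y v w := by
  rw [metricInChart_apply, ofChart_toChart hy, ofChart_toChart hy]

theorem chartMetric_extChartAt (hy : y ∈ (extChartAt (𝓡 n) x₀).source)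
    (v w : TangentSpace (𝓡 n) y) :
    S.chartMetric x₀ (extChartAt (𝓡 n) x₀ y) (toChart x₀ y v) (toChart x₀ y w)
      = S.metric y v w := by
  rw [chartMetric, (extChartAt (𝓡 n) x₀).left_inv hy, metricInChart_toChart hy]

theorem chartTime_extChartAt (hy : y ∈ (extChartAt (𝓡 n) x₀).source) :
    S.chartTime x₀ (extChartAt (𝓡 n) x₀ y) = toChart x₀ y (S.timeField y) := by
  rw [chartTime, (extChartAt (𝓡 n) x₀).left_inv hy]

theorem isFutureTimelike_iff (hy : y ∈ (extChartAt (𝓡 n) x₀).source) (v : TangentSpace (𝓡 n) y) :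
    S.IsFutureTimelike y v ↔
      S.chartMetric x₀ (extChartAt (𝓡 n) x₀ y) (toChart x₀ y v) (toChart x₀ y v) < 0 ∧
      S.chartMetric x₀ (extChartAt (𝓡 n) x₀ y) (S.chartTime x₀ (extChartAt (𝓡 n) x₀ y))
        (toChart x₀ y v) < 0 := by
  rw [chartTime_extChartAt hy, chartMetric_extChartAt hy, chartMetric_extChartAt hy,
    IsFutureTimelike]

theorem isFutureCausal_iff (hy : y ∈ (extChartAt (𝓡 n) x₀).source) (v : TangentSpace (𝓡 n) y) :
    S.IsFutureCausal y v ↔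
      S.chartMetric x₀ (extChartAt (𝓡 n) x₀ y) (toChart x₀ y v) (toChart x₀ y v) ≤ 0 ∧
      S.chartMetric x₀ (extChartAt (𝓡 n) x₀ y) (S.chartTime x₀ (extChartAt (𝓡 n) x₀ y))
        (toChart x₀ y v) < 0 := by
  rw [chartTime_extChartAt hy, chartMetric_extChartAt hy, chartMetric_extChartAt hy,
    IsFutureCausal]
  refine ⟨fun h ↦ h.2, fun h ↦ ⟨?_, h⟩⟩
  rintro rfl
  simpa using h.2

theorem isLorentzForm_metricInChart (hn : 0 < n) (hy : y ∈ (extChartAt (𝓡 n) x₀).source) :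
    IsLorentzForm (S.metricInChart x₀ y) := by
  obtain ⟨b, hb⟩ := S.signature y
  let e : TangentSpace (𝓡 n) y ≃ₗ[ℝ] EuclideanSpace ℝ (Fin n) :=
    { toLinearMap := (toChart x₀ y).toLinearMap
      invFun := ofChart x₀ y
      left_inv := ofChart_toChart hy
      right_inv := toChart_ofChart hy }
  refine IsLorentzForm.of_basis hn (b.map e) (fun v w ↦ S.symm y _ _) fun i j ↦ ?_
  rw [← hb i j, ← metricInChart_toChart hy, b.map_apply, b.map_apply]
  rfl

/-- The tangent bundle of a `C³` manifold is a `C²` vector bundle, so coordinate vector fields with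
constant components are `C²`. -/
theorem contMDiffOn_ofChart (hM : IsManifold (𝓡 n) 3 M) (x₀ : M) (v : EuclideanSpace ℝ (Fin n)) :
    ContMDiffOn (𝓡 n) ((𝓡 n).prod 𝓘(ℝ, EuclideanSpace ℝ (Fin n))) 2
      (fun y ↦ TotalSpace.mk' (EuclideanSpace ℝ (Fin n)) (E := TangentSpace (𝓡 n)) y
        (ofChart x₀ y v)) (extChartAt (𝓡 n) x₀).source := by
  have : IsManifold (𝓡 n) (2 + 1) M := by
    rwa [show (2 + 1 : ℕ∞ω) = 3 by norm_num]
  have : ContMDiffVectorBundle 2 (EuclideanSpace ℝ (Fin n)) (TangentSpace (𝓡 n) : M → Type _)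
      (𝓡 n) := TangentBundle.contMDiffVectorBundle
  set e := trivializationAt (EuclideanSpace ℝ (Fin n)) (TangentSpace (𝓡 n)) x₀
  have hbase : ∀ y ∈ (extChartAt (𝓡 n) x₀).source, y ∈ e.baseSet := fun y hy ↦ by
    simpa [e] using hy
  have h1 : ContMDiffOn (𝓡 n) ((𝓡 n).prod 𝓘(ℝ, EuclideanSpace ℝ (Fin n))) 2
      (fun y : M ↦ (y, v)) (extChartAt (𝓡 n) x₀).source :=
    contMDiffOn_id.prodMk contMDiffOn_const
  refine ((e.contMDiffOn_symm (IB := 𝓡 n) (n := 2)).comp h1 fun y hy ↦ ?_).congr fun y hy ↦ ?_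
  · exact e.mem_target.2 (hbase y hy)
  · have h2 : ofChart x₀ y v = e.symm y v := by
      rw [ofChart, Bundle.Trivialization.symmL_apply _ (hbase y hy)]
    rw [h2]
    exact e.mk_symm (hbase y hy) v

/-- It suffices to treat the coefficients, which are values of the metric on the `C²` coordinate
fields; the metric is `C²` because `r - 1 ≥ 2`. -/
theorem contDiffOn_chartMetric (hM : IsManifold (𝓡 n) 3 M) (hr : 3 ≤ r) (S : Spacetime n r M)
    (x₀ : M) : ContDiffOn ℝ 2 (S.chartMetric x₀) (extChartAt (𝓡 n) x₀).target := by
  have : IsManifold (𝓡 n) (2 + 1) M := by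
    rwa [show (2 + 1 : ℕ∞ω) = 3 by norm_num]
  have : ContMDiffVectorBundle 2 (EuclideanSpace ℝ (Fin n)) (TangentSpace (𝓡 n) : M → Type _)
      (𝓡 n) := TangentBundle.contMDiffVectorBundle
  have : IsManifold (𝓡 n) 2 M := IsManifold.of_le (n := 3) (by norm_num)
  have hr2 : (2 : ℕ∞ω) ≤ ((r - 1 : ℕ∞) : ℕ∞ω) := by
    have : (2 : ℕ∞) ≤ r - 1 := by
      have h := tsub_le_tsub_right hr 1
      rwa [show (3 : ℕ∞) - 1 = 2 by rfl] at h
    exact WithTop.coe_le_coe.2 this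
  have key : ∀ v w, ContDiffOn ℝ 2 (fun z ↦ S.chartMetric x₀ z v w)
      (extChartAt (𝓡 n) x₀).target := by
    intro v w
    have h0 : ContMDiffOn (𝓡 n) ((𝓡 n).prod 𝓘(ℝ, ℝ)) 2
        (fun y ↦ TotalSpace.mk' ℝ (E := Bundle.Trivial M ℝ) y
          (S.metric y (ofChart x₀ y v) (ofChart x₀ y w))) (extChartAt (𝓡 n) x₀).source :=
      ContMDiffOn.clm_bundle_apply₂ (F₁ := EuclideanSpace ℝ (Fin n))
        (F₂ := EuclideanSpace ℝ (Fin n)) (S.contMDiff_metric.of_le hr2).contMDiffOn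
        (contMDiffOn_ofChart hM x₀ v) (contMDiffOn_ofChart hM x₀ w)
    have h1 : ContMDiffOn (𝓡 n) 𝓘(ℝ, ℝ) 2
        (fun y ↦ S.metric y (ofChart x₀ y v) (ofChart x₀ y w)) (extChartAt (𝓡 n) x₀).source := by
      intro y hy
      have := h0 y hy
      simp only [contMDiffWithinAt_totalSpace] at this
      exact this.2
    exact (h1.comp (contMDiffOn_extChartAt_symm x₀)
      fun z hz ↦ (extChartAt (𝓡 n) x₀).map_target hz).contDiffOn
  rw [contDiffOn_clm_apply]
  intro v
  rw [contDiffOn_clm_apply]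
  exact key v

theorem continuousOn_chartTime (S : Spacetime n r M) (x₀ : M) :
    ContinuousOn (S.chartTime x₀) (extChartAt (𝓡 n) x₀).target := by
  set e := trivializationAt (EuclideanSpace ℝ (Fin n)) (TangentSpace (𝓡 n)) x₀
  have hmem : ∀ y ∈ (extChartAt (𝓡 n) x₀).source, y ∈ e.baseSet := fun y hy ↦ by
    simpa [e] using hy
  have h1 : ContinuousOn (fun y : M ↦ (e ⟨y, S.timeField y⟩).2) (extChartAt (𝓡 n) x₀).source :=
    continuous_snd.comp_continuousOn (e.continuousOn.comp S.continuous_timeField.continuousOn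
      fun y hy ↦ e.mem_source.2 (hmem y hy))
  refine (h1.comp (continuousOn_extChartAt_symm x₀)
    fun z hz ↦ (extChartAt (𝓡 n) x₀).map_target hz).congr fun z hz ↦ ?_
  exact e.continuousLinearMapAt_apply_of_mem ℝ (hmem _ ((extChartAt (𝓡 n) x₀).map_target hz)) _

theorem isLorentzMetricOn_chart (hM : IsManifold (𝓡 n) 3 M) (hn : 0 < n) (hr : 3 ≤ r)
    (S : Spacetime n r M) (x₀ : M) :
    IsLorentzMetricOn (S.chartMetric x₀) (S.chartTime x₀) (extChartAt (𝓡 n) x₀).target where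
  contDiffOn := contDiffOn_chartMetric hM hr S x₀
  isLorentzForm z hz := isLorentzForm_metricInChart hn ((extChartAt (𝓡 n) x₀).map_target hz)
  continuousOn := continuousOn_chartTime S x₀
  timelike z hz := by
    rw [chartMetric, chartTime, metricInChart_toChart ((extChartAt (𝓡 n) x₀).map_target hz)]
    exact S.timeField_timelike _

end Spacetime

/-! ### Reparametrization, time reversal and curves in charts -/

namespace Spacetime

variable {n : ℕ} {r : ℕ∞} {M : Type*} [TopologicalSpace M]
  [ChartedSpace (EuclideanSpace ℝ (Fin n)) M]

/-- No order of `a` and `b` is imposed: `a < b` yields parts of a curve, while `a = 1`, `b = 0`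
yields the reversed curve. -/
theorem hasMFDerivWithinAt_comp_affine {γ : ℝ → M} {a b t : ℝ} (ha : a ∈ Icc (0 : ℝ) 1)
    (hb : b ∈ Icc (0 : ℝ) 1)
    (hγ : MDifferentiableWithinAt 𝓘(ℝ, ℝ) (𝓡 n) γ (Icc (0 : ℝ) 1) (a + t * (b - a))) :
    HasMFDerivWithinAt 𝓘(ℝ, ℝ) (𝓡 n) (γ ∘ fun t ↦ a + t * (b - a)) (Icc (0 : ℝ) 1) t
      ((mfderivWithin 𝓘(ℝ, ℝ) (𝓡 n) γ (Icc (0 : ℝ) 1) (a + t * (b - a))).comp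
        (ContinuousLinearMap.toSpanSingleton ℝ (b - a))) := by
  have hσ : HasDerivAt (fun t : ℝ ↦ a + t * (b - a)) (b - a) t := by
    simpa using ((hasDerivAt_id t).mul_const (b - a)).const_add a
  refine HasMFDerivWithinAt.comp t hγ.hasMFDerivWithinAt
    hσ.hasFDerivAt.hasFDerivWithinAt.hasMFDerivWithinAt fun s hs ↦ ?_
  have : a + s * (b - a) = (1 - s) * a + s * b := by ring
  have h1 := mul_nonneg (sub_nonneg.2 hs.2) ha.1
  have h2 := mul_nonneg hs.1 hb.1
  have h3 := mul_nonneg (sub_nonneg.2 hs.2) (sub_nonneg.2 ha.2)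
  have h4 := mul_nonneg hs.1 (sub_nonneg.2 hb.2)
  constructor <;> simp only <;> linarith

theorem affine_mem_Icc {a b t : ℝ} (ha : a ∈ Icc (0 : ℝ) 1) (hb : b ∈ Icc (0 : ℝ) 1)
    (ht : t ∈ Icc (0 : ℝ) 1) : a + t * (b - a) ∈ Icc (0 : ℝ) 1 := by
  have : a + t * (b - a) = (1 - t) * a + t * b := by ring
  have h1 := mul_nonneg (sub_nonneg.2 ht.2) ha.1
  have h2 := mul_nonneg ht.1 hb.1
  have h3 := mul_nonneg (sub_nonneg.2 ht.2) (sub_nonneg.2 ha.2)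
  have h4 := mul_nonneg ht.1 (sub_nonneg.2 hb.2)
  constructor <;> linarith

theorem apply_comp_toSpanSingleton_one {F : Type*} [NormedAddCommGroup F] [NormedSpace ℝ F]
    (L : ℝ →L[ℝ] F) (d : ℝ) :
    (L.comp (ContinuousLinearMap.toSpanSingleton ℝ d)) 1 = d • L 1 := by
  simp [← map_smul]

theorem velocity_comp_affine {γ : ℝ → M} {a b t : ℝ} (ha : a ∈ Icc (0 : ℝ) 1)
    (hb : b ∈ Icc (0 : ℝ) 1) (ht : t ∈ Icc (0 : ℝ) 1)
    (hγ : MDifferentiableWithinAt 𝓘(ℝ, ℝ) (𝓡 n) γ (Icc (0 : ℝ) 1) (a + t * (b - a))) :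
    velocity n (γ ∘ fun t ↦ a + t * (b - a)) t = (b - a) • velocity n γ (a + t * (b - a)) := by
  have h := (hasMFDerivWithinAt_comp_affine ha hb hγ).mfderivWithin
    ((uniqueDiffOn_Icc_zero_one t ht).uniqueMDiffWithinAt)
  have h1 := DFunLike.congr_fun h (1 : ℝ)
  exact h1.trans (apply_comp_toSpanSingleton_one (F := EuclideanSpace ℝ (Fin n)) _ _)

theorem contMDiffOn_comp_affine {γ : ℝ → M} {a b : ℝ} (ha : a ∈ Icc (0 : ℝ) 1)
    (hb : b ∈ Icc (0 : ℝ) 1) (hγ : ContMDiffOn 𝓘(ℝ, ℝ) (𝓡 n) 1 γ (Icc (0 : ℝ) 1)) :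
    ContMDiffOn 𝓘(ℝ, ℝ) (𝓡 n) 1 (γ ∘ fun t ↦ a + t * (b - a)) (Icc (0 : ℝ) 1) := by
  have h1 : ContDiff ℝ 1 fun t : ℝ ↦ a + t * (b - a) := by fun_prop
  exact hγ.comp h1.contMDiff.contMDiffOn fun t ht ↦ affine_mem_Icc ha hb ht

variable [IsManifold (𝓡 n) 1 M]

/-- A part of a timelike curve is a timelike curve. -/
theorem timelikeSegment_of_lt {S : Spacetime n r M} {γ : ℝ → M}
    (hγ : ContMDiffOn 𝓘(ℝ, ℝ) (𝓡 n) 1 γ (Icc (0 : ℝ) 1))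
    (h : ∀ t ∈ Icc (0 : ℝ) 1, S.IsFutureTimelike (γ t) (velocity n γ t)) {a b : ℝ}
    (ha : a ∈ Icc (0 : ℝ) 1) (hb : b ∈ Icc (0 : ℝ) 1) (hab : a < b) :
    S.TimelikeSegment (γ a) (γ b) := by
  refine ⟨γ ∘ fun t ↦ a + t * (b - a), contMDiffOn_comp_affine ha hb hγ, by simp, by simp,
    fun t ht ↦ ?_⟩
  have hm := affine_mem_Icc ha hb ht
  rw [velocity_comp_affine ha hb ht (hγ.mdifferentiableOn one_ne_zero _ hm)]
  obtain ⟨h1, h2⟩ := h _ hm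
  have hpos : 0 < b - a := sub_pos.2 hab
  refine ⟨?_, ?_⟩
  · simp only [Function.comp_apply, map_smul, smul_apply, smul_eq_mul]
    exact mul_neg_of_pos_of_neg hpos (mul_neg_of_pos_of_neg hpos h1)
  · simp only [Function.comp_apply, map_smul, smul_eq_mul]
    exact mul_neg_of_pos_of_neg hpos h2

/-- The spacetime with the opposite time orientation. -/
noncomputable def reverse (S : Spacetime n r M) : Spacetime n r M where
  metric := S.metric
  symm := S.symm
  signature := S.signature
  contMDiff_metric := S.contMDiff_metric
  timeField x := -S.timeField x
  timeField_timelike x := by simpa using S.timeField_timelike x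
  continuous_timeField := by
    rw [continuous_iff_continuousAt]
    intro x
    have h := S.continuous_timeField.continuousAt (x := x)
    rw [FiberBundle.continuousAt_totalSpace] at h ⊢
    refine ⟨h.1, ?_⟩
    have hx : ∀ᶠ y in 𝓝 x, y ∈ (trivializationAt (EuclideanSpace ℝ (Fin n))
        (TangentSpace (𝓡 n)) x).baseSet :=
      (trivializationAt (EuclideanSpace ℝ (Fin n)) (TangentSpace (𝓡 n)) x).open_baseSet.mem_nhds
        (FiberBundle.mem_baseSet_trivializationAt' x)
    refine h.2.neg.congr ?_
    filter_upwards [hx] with y hy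
    have e := map_neg ((trivializationAt (EuclideanSpace ℝ (Fin n))
      (TangentSpace (𝓡 n)) x).continuousLinearMapAt ℝ y) (S.timeField y)
    rw [Bundle.Trivialization.continuousLinearMapAt_apply_of_mem _ _ hy,
      Bundle.Trivialization.continuousLinearMapAt_apply_of_mem _ _ hy] at e
    exact e.symm

theorem reverse_reverse (S : Spacetime n r M) : S.reverse.reverse = S := by
  cases S
  simp [reverse]

/-- Run the curve backwards: velocity and time field both change sign, so all products in the
definition are preserved. -/
theorem TimelikeSegment.reverse {S : Spacetime n r M} {x y : M} (h : S.TimelikeSegment x y) :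
    S.reverse.TimelikeSegment y x := by
  obtain ⟨γ, hγ, rfl, rfl, h⟩ := h
  have h0 := left_mem_Icc.2 (zero_le_one' ℝ)
  have h1 := right_mem_Icc.2 (zero_le_one' ℝ)
  refine ⟨γ ∘ fun t ↦ 1 + t * (0 - 1), contMDiffOn_comp_affine h1 h0 hγ, by simp, by simp,
    fun t ht ↦ ?_⟩
  have hm := affine_mem_Icc h1 h0 ht
  rw [velocity_comp_affine h1 h0 ht (hγ.mdifferentiableOn one_ne_zero _ hm)]
  obtain ⟨h1, h2⟩ := h _ hm
  refine ⟨?_, ?_⟩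
  · simpa [Spacetime.reverse] using h1
  · simpa [Spacetime.reverse] using h2

theorem CausalSegment.reverse {S : Spacetime n r M} {x y : M} (h : S.CausalSegment x y) :
    S.reverse.CausalSegment y x := by
  obtain ⟨γ, hγ, rfl, rfl, h⟩ := h
  have h0 := left_mem_Icc.2 (zero_le_one' ℝ)
  have h1 := right_mem_Icc.2 (zero_le_one' ℝ)
  refine ⟨γ ∘ fun t ↦ 1 + t * (0 - 1), contMDiffOn_comp_affine h1 h0 hγ, by simp, by simp,
    fun t ht ↦ ?_⟩
  have hm := affine_mem_Icc h1 h0 ht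
  rw [velocity_comp_affine h1 h0 ht (hγ.mdifferentiableOn one_ne_zero _ hm)]
  obtain ⟨h3, h1, h2⟩ := h _ hm
  refine ⟨?_, ?_, ?_⟩
  · simpa using h3
  · simpa [Spacetime.reverse] using h1
  · simpa [Spacetime.reverse] using h2

theorem timelikeSegment_reverse_iff {S : Spacetime n r M} {x y : M} :
    S.reverse.TimelikeSegment x y ↔ S.TimelikeSegment y x :=
  ⟨fun h ↦ by simpa only [reverse_reverse] using h.reverse, fun h ↦ h.reverse⟩

theorem causalSegment_reverse_iff {S : Spacetime n r M} {x y : M} :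
    S.reverse.CausalSegment x y ↔ S.CausalSegment y x :=
  ⟨fun h ↦ by simpa only [reverse_reverse] using h.reverse, fun h ↦ h.reverse⟩

theorem mem_chronRel_reverse {S : Spacetime n r M} {x y : M} :
    (x, y) ∈ S.reverse.chronRel ↔ (y, x) ∈ S.chronRel := by
  have : S.reverse.TimelikeSegment = Function.swap S.TimelikeSegment := by
    ext x y; exact timelikeSegment_reverse_iff
  simp only [chronRel, mem_ofPred_eq, this]
  exact Relation.transGen_swap

theorem mem_causalRel_reverse {S : Spacetime n r M} {x y : M} :
    (x, y) ∈ S.reverse.causalRel ↔ (y, x) ∈ S.causalRel := by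
  have : S.reverse.CausalSegment = Function.swap S.CausalSegment := by
    ext x y; exact causalSegment_reverse_iff
  simp only [causalRel, mem_ofPred_eq, this]
  exact Relation.reflTransGen_swap

theorem chronFuture_reverse (S : Spacetime n r M) (x : M) :
    S.reverse.chronFuture x = S.chronPast x :=
  ext fun _ ↦ mem_chronRel_reverse

theorem chronPast_reverse (S : Spacetime n r M) (x : M) :
    S.reverse.chronPast x = S.chronFuture x :=
  ext fun _ ↦ mem_chronRel_reverse

section Chart

theorem hasDerivWithinAt_chart_comp {x₀ : M} {γ : ℝ → M} {t : ℝ}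
    (hγ : MDifferentiableWithinAt 𝓘(ℝ, ℝ) (𝓡 n) γ (Icc (0 : ℝ) 1) t)
    (ht : γ t ∈ (extChartAt (𝓡 n) x₀).source) :
    HasDerivWithinAt (extChartAt (𝓡 n) x₀ ∘ γ) (toChart x₀ (γ t) (velocity n γ t))
      (Icc (0 : ℝ) 1) t := by
  have h1 := (mdifferentiableAt_extChartAt (I := 𝓡 n) (x := x₀) (y := γ t)
    (by simpa using ht)).hasMFDerivAt.comp_hasMFDerivWithinAt t hγ.hasMFDerivWithinAt
  have h2 : HasFDerivWithinAt (extChartAt (𝓡 n) x₀ ∘ γ)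
    (_ : ℝ →L[ℝ] EuclideanSpace ℝ (Fin n)) (Icc (0 : ℝ) 1) t := h1.hasFDerivWithinAt
  rw [toChart_eq_mfderiv ht]
  exact h2.hasDerivWithinAt

/-- A `C^1` curve in the target of a chart defines a `C^1` curve in the manifold. -/
theorem exists_curve_of_chart {x₀ : M} {c u : ℝ → EuclideanSpace ℝ (Fin n)}
    (hc : ∀ t, HasDerivAt c (u t) t) (hu : Continuous u)
    (hmem : ∀ t ∈ Icc (0 : ℝ) 1, c t ∈ (extChartAt (𝓡 n) x₀).target) :
    ∃ γ : ℝ → M, ContMDiffOn 𝓘(ℝ, ℝ) (𝓡 n) 1 γ (Icc (0 : ℝ) 1) ∧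
      γ 0 = (extChartAt (𝓡 n) x₀).symm (c 0) ∧ γ 1 = (extChartAt (𝓡 n) x₀).symm (c 1) ∧
      ∀ t ∈ Icc (0 : ℝ) 1, γ t ∈ (extChartAt (𝓡 n) x₀).source ∧
        extChartAt (𝓡 n) x₀ (γ t) = c t ∧ toChart x₀ (γ t) (velocity n γ t) = u t := by
  have hcd : ContDiff ℝ 1 c := by
    rw [contDiff_one_iff_deriv]
    refine ⟨fun t ↦ (hc t).differentiableAt, ?_⟩
    rwa [show deriv c = u from funext fun t ↦ (hc t).deriv]
  have hγ : ContMDiffOn 𝓘(ℝ, ℝ) (𝓡 n) 1 ((extChartAt (𝓡 n) x₀).symm ∘ c) (Icc (0 : ℝ) 1) :=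
    (contMDiffOn_extChartAt_symm x₀).comp hcd.contMDiff.contMDiffOn hmem
  refine ⟨(extChartAt (𝓡 n) x₀).symm ∘ c, hγ, rfl, rfl, fun t ht ↦ ?_⟩
  have hs := (extChartAt (𝓡 n) x₀).map_target (hmem t ht)
  refine ⟨hs, (extChartAt (𝓡 n) x₀).right_inv (hmem t ht), ?_⟩
  have h1 := hasDerivWithinAt_chart_comp (hγ.mdifferentiableOn one_ne_zero t ht) hs
  have h2 : HasDerivWithinAt (extChartAt (𝓡 n) x₀ ∘ (extChartAt (𝓡 n) x₀).symm ∘ c) (u t)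
      (Icc (0 : ℝ) 1) t :=
    (hc t).hasDerivWithinAt.congr (fun s hs ↦ (extChartAt (𝓡 n) x₀).right_inv (hmem s hs))
      ((extChartAt (𝓡 n) x₀).right_inv (hmem t ht))
  exact (uniqueDiffOn_Icc_zero_one t ht).eq_deriv _ h1 h2

variable {S : Spacetime n r M} {x₀ : M} {ρ : ℝ}
  {Γ : GeodesicFamily (S.chartMetric x₀) (extChartAt (𝓡 n) x₀ x₀) ρ}

theorem timelikeSegment_of_isTimelike
    (hball : Metric.ball (extChartAt (𝓡 n) x₀ x₀) (4 * ρ) ⊆ (extChartAt (𝓡 n) x₀).target)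
    (hG : IsLorentzMetricOn (S.chartMetric x₀) (S.chartTime x₀)
      (Metric.ball (extChartAt (𝓡 n) x₀ x₀) (4 * ρ)))
    {p q : EuclideanSpace ℝ (Fin n)} (hp : p ∈ Metric.ball (extChartAt (𝓡 n) x₀ x₀) ρ)
    (hq : q ∈ Metric.ball (extChartAt (𝓡 n) x₀ x₀) ρ) (h : Γ.IsTimelike (S.chartTime x₀) p q) :
    S.TimelikeSegment ((extChartAt (𝓡 n) x₀).symm p) ((extChartAt (𝓡 n) x₀).symm q) := by
  obtain ⟨γ, hγ, h0, h1, hγc⟩ := exists_curve_of_chart (x₀ := x₀) (Γ.hasDerivAt_curve p q)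
    (Γ.continuous_velocity p q) fun t ht ↦ hball (Γ.curve_mem_ball le_rfl hp hq ht)
  rw [Γ.curve_zero] at h0
  rw [Γ.curve_one] at h1
  refine ⟨γ, hγ, h0, h1, fun t ht ↦ ?_⟩
  obtain ⟨hs, e1, e2⟩ := hγc t ht
  rw [isFutureTimelike_iff hs, e1, e2]
  exact h.velocity_future hG hp hq ht

theorem causalSegment_of_isCausal
    (hball : Metric.ball (extChartAt (𝓡 n) x₀ x₀) (4 * ρ) ⊆ (extChartAt (𝓡 n) x₀).target)
    (hG : IsLorentzMetricOn (S.chartMetric x₀) (S.chartTime x₀)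
      (Metric.ball (extChartAt (𝓡 n) x₀ x₀) (4 * ρ)))
    {p q : EuclideanSpace ℝ (Fin n)} (hp : p ∈ Metric.ball (extChartAt (𝓡 n) x₀ x₀) ρ)
    (hq : q ∈ Metric.ball (extChartAt (𝓡 n) x₀ x₀) ρ) (hpq : p ≠ q)
    (h : Γ.IsCausal (S.chartTime x₀) p q) :
    S.CausalSegment ((extChartAt (𝓡 n) x₀).symm p) ((extChartAt (𝓡 n) x₀).symm q) := by
  obtain ⟨γ, hγ, h0, h1, hγc⟩ := exists_curve_of_chart (x₀ := x₀) (Γ.hasDerivAt_curve p q)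
    (Γ.continuous_velocity p q) fun t ht ↦ hball (Γ.curve_mem_ball le_rfl hp hq ht)
  rw [Γ.curve_zero] at h0
  rw [Γ.curve_one] at h1
  refine ⟨γ, hγ, h0, h1, fun t ht ↦ ?_⟩
  obtain ⟨hs, e1, e2⟩ := hγc t ht
  rw [isFutureCausal_iff hs, e1, e2]
  exact h.velocity_future hG hp hq hpq ht

end Chart

end Spacetime

/-! ### Chronology of the spacetime -/

namespace Spacetime

open Filter

variable {n : ℕ} {r : ℕ∞} {M : Type*} [TopologicalSpace M]
  [ChartedSpace (EuclideanSpace ℝ (Fin n)) M]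

/-- Take the first time outside the open ball. Since `M` is Hausdorff, the compact closed coordinate
ball is closed in `M`, so the curve is still in the chart domain at that time. -/
theorem exists_mem_sphere_of_exit [T2Space M] {x₀ : M} {γ : ℝ → M} {δ : ℝ}
    (hγ : ContinuousOn γ (Icc (0 : ℝ) 1))
    (hδ : Metric.closedBall (extChartAt (𝓡 n) x₀ x₀) δ ⊆ (extChartAt (𝓡 n) x₀).target)
    (h0 : γ 0 ∈ (extChartAt (𝓡 n) x₀).source ∩
      extChartAt (𝓡 n) x₀ ⁻¹' Metric.ball (extChartAt (𝓡 n) x₀ x₀) δ)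
    (hex : ¬ ∀ t ∈ Icc (0 : ℝ) 1, γ t ∈ (extChartAt (𝓡 n) x₀).source ∩
      extChartAt (𝓡 n) x₀ ⁻¹' Metric.ball (extChartAt (𝓡 n) x₀ x₀) δ) :
    ∃ s ∈ Ioc (0 : ℝ) 1, extChartAt (𝓡 n) x₀ (γ s) ∈ Metric.sphere (extChartAt (𝓡 n) x₀ x₀) δ ∧
      ∀ t ∈ Icc 0 s, γ t ∈ (extChartAt (𝓡 n) x₀).source ∩
        extChartAt (𝓡 n) x₀ ⁻¹' Metric.closedBall (extChartAt (𝓡 n) x₀ x₀) δ := by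
  set φ := extChartAt (𝓡 n) x₀
  set B := φ.source ∩ φ ⁻¹' Metric.ball (φ x₀) δ with hB
  have hBo : IsOpen B :=
    (continuousOn_extChartAt x₀).isOpen_inter_preimage (isOpen_extChartAt_source x₀)
      Metric.isOpen_ball
  have hK : IsClosed (φ.symm '' Metric.closedBall (φ x₀) δ) :=
    ((isCompact_closedBall (φ x₀) δ).image_of_continuousOn
      ((continuousOn_extChartAt_symm x₀).mono hδ)).isClosed
  have hKφ : ∀ y ∈ φ.symm '' Metric.closedBall (φ x₀) δ,
      y ∈ φ.source ∩ φ ⁻¹' Metric.closedBall (φ x₀) δ := by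
    rintro _ ⟨z, hz, rfl⟩
    refine ⟨φ.map_target (hδ hz), ?_⟩
    rwa [mem_preimage, φ.right_inv (hδ hz)]
  have hA : IsClosed (Icc (0 : ℝ) 1 ∩ γ ⁻¹' Bᶜ) :=
    hγ.preimage_isClosed_of_isClosed isClosed_Icc hBo.isClosed_compl
  have hne : (Icc (0 : ℝ) 1 ∩ γ ⁻¹' Bᶜ).Nonempty := by
    push Not at hex
    obtain ⟨t, ht, ht'⟩ := hex
    exact ⟨t, ht, ht'⟩
  have hbdd : BddBelow (Icc (0 : ℝ) 1 ∩ γ ⁻¹' Bᶜ) := ⟨0, fun t ht ↦ ht.1.1⟩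
  set s := sInf (Icc (0 : ℝ) 1 ∩ γ ⁻¹' Bᶜ)
  obtain ⟨hs, hsB⟩ := hA.csInf_mem hne hbdd
  have hs0 : 0 < s := hs.1.lt_of_ne fun h ↦ hsB (by rw [← h]; exact h0)
  have hlt : ∀ t ∈ Ico 0 s, γ t ∈ B := by
    intro t ht
    by_contra hn
    exact (csInf_le hbdd ⟨⟨ht.1, ht.2.le.trans hs.2⟩, hn⟩).not_gt ht.2
  have hIcc : ∀ t ∈ Icc 0 s, γ t ∈ φ.source ∩ φ ⁻¹' Metric.closedBall (φ x₀) δ := by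
    intro t ht
    refine hKφ _ ?_
    have hcl := (hγ.mono (Icc_subset_Icc_right hs.2)).preimage_isClosed_of_isClosed isClosed_Icc hK
    have hsub : Ico 0 s ⊆ Icc 0 s ∩ γ ⁻¹' (φ.symm '' Metric.closedBall (φ x₀) δ) := by
      intro t ht
      have hb := hlt t ht
      exact ⟨Ico_subset_Icc_self ht, φ (γ t), Metric.ball_subset_closedBall hb.2,
        φ.left_inv hb.1⟩
    have := closure_minimal hsub hcl
    rw [closure_Ico hs0.ne] at this
    exact (this ht).2
  refine ⟨s, ⟨hs0, hs.2⟩, ?_, hIcc⟩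
  obtain ⟨h1, h2⟩ := hIcc s (right_mem_Icc.2 hs0.le)
  rw [Metric.mem_sphere]
  refine le_antisymm h2 (not_lt.1 fun h ↦ hsB ⟨h1, h⟩)

variable [IsManifold (𝓡 n) 1 M] {S : Spacetime n r M} {x₀ x y z : M}

theorem chronRel_trans (hxy : (x, y) ∈ S.chronRel) (hyz : (y, z) ∈ S.chronRel) :
    (x, z) ∈ S.chronRel :=
  Relation.TransGen.trans hxy hyz

/-- Charts in which nearby points are joined by geodesics. -/
theorem exists_geodesicFamily_chart (hM : IsManifold (𝓡 n) 3 M) (hn : 0 < n) (hr : 3 ≤ r)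
    (S : Spacetime n r M) (x₀ : M) :
    ∃ ρ > 0, Metric.ball (extChartAt (𝓡 n) x₀ x₀) (4 * ρ) ⊆ (extChartAt (𝓡 n) x₀).target ∧
      IsLorentzMetricOn (S.chartMetric x₀) (S.chartTime x₀)
        (Metric.ball (extChartAt (𝓡 n) x₀ x₀) (4 * ρ)) ∧
      Nonempty (GeodesicFamily (S.chartMetric x₀) (extChartAt (𝓡 n) x₀ x₀) ρ) := by
  have hL := isLorentzMetricOn_chart hM hn hr S x₀
  have hnhds := extChartAt_target_mem_nhds (I := 𝓡 n) x₀
  obtain ⟨R, hR, hRt⟩ := Metric.mem_nhds_iff.1 hnhds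
  obtain ⟨ρ, hρ, hρR, hΓ⟩ := exists_geodesicFamily (hL.contDiffOn.contDiffAt hnhds)
    (Filter.mem_of_superset hnhds fun z hz w hw ↦
      (hL.isLorentzForm z hz).eq_zero_of_apply_eq_zero (hL.timelike z hz) hw) hR
  have hsub := (Metric.ball_subset_ball hρR).trans hRt
  exact ⟨ρ, hρ, hsub, hL.mono hsub, hΓ⟩

section Local

variable {ρ : ℝ} {Γ : GeodesicFamily (S.chartMetric x₀) (extChartAt (𝓡 n) x₀ x₀) ρ}

/-- Timelike curves in a normal chart preserve the chronological future of a point. -/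
theorem isTimelike_chart_of_curve
    (hG : IsLorentzMetricOn (S.chartMetric x₀) (S.chartTime x₀)
      (Metric.ball (extChartAt (𝓡 n) x₀ x₀) (4 * ρ))) {γ : ℝ → M}
    (hγ : ContMDiffOn 𝓘(ℝ, ℝ) (𝓡 n) 1 γ (Icc (0 : ℝ) 1))
    (h : ∀ t ∈ Icc (0 : ℝ) 1, S.IsFutureTimelike (γ t) (velocity n γ t)) {a b : ℝ}
    (ha : 0 ≤ a) (hb : b ≤ 1) (hab : a < b)
    (hmem : ∀ t ∈ Icc a b, γ t ∈ (extChartAt (𝓡 n) x₀).source ∩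
      extChartAt (𝓡 n) x₀ ⁻¹' Metric.ball (extChartAt (𝓡 n) x₀ x₀) ρ)
    {p : EuclideanSpace ℝ (Fin n)} (hp : p ∈ Metric.ball (extChartAt (𝓡 n) x₀ x₀) ρ)
    (hpa : extChartAt (𝓡 n) x₀ (γ a) = p ∨
      Γ.IsTimelike (S.chartTime x₀) p (extChartAt (𝓡 n) x₀ (γ a))) :
    Γ.IsTimelike (S.chartTime x₀) p (extChartAt (𝓡 n) x₀ (γ b)) := by
  have hsub : Icc a b ⊆ Icc (0 : ℝ) 1 := Icc_subset_Icc ha hb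
  have hd : ∀ s ∈ Icc a b, HasDerivWithinAt (extChartAt (𝓡 n) x₀ ∘ γ)
      (toChart x₀ (γ s) (velocity n γ s)) (Icc a b) s := fun s hs ↦
    (hasDerivWithinAt_chart_comp (hγ.mdifferentiableOn one_ne_zero s (hsub hs))
      (hmem s hs).1).mono hsub
  have hf := fun s (hs : s ∈ Icc a b) ↦ (isFutureTimelike_iff (hmem s hs).1 _).1 (h s (hsub hs))
  rcases hpa with rfl | hpa
  · exact GeodesicFamily.isTimelike_of_timelike_curve hG (α := extChartAt (𝓡 n) x₀ ∘ γ) hab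
      (fun s hs ↦ (hmem s hs).2) hd (fun s hs ↦ (hf s hs).1) (fun s hs ↦ (hf s hs).2)
  · exact GeodesicFamily.IsTimelike.of_causal_curve hG (α := extChartAt (𝓡 n) x₀ ∘ γ) hab.le hp
      (fun s hs ↦ (hmem s hs).2) hd (fun s hs ↦ (hf s hs).1.le) (fun s hs ↦ (hf s hs).2) hpa

/-- Only the last segment matters: a terminal piece of it lies in the ball, and its initial point
serves as `p`. -/
theorem exists_isTimelike_of_chronRel (hρ : 0 < ρ)
    (hG : IsLorentzMetricOn (S.chartMetric x₀) (S.chartTime x₀)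
      (Metric.ball (extChartAt (𝓡 n) x₀ x₀) (4 * ρ))) {w : M} (hw : (w, x₀) ∈ S.chronRel) :
    ∃ p ∈ Metric.ball (extChartAt (𝓡 n) x₀ x₀) ρ,
      Γ.IsTimelike (S.chartTime x₀) p (extChartAt (𝓡 n) x₀ x₀) ∧
      (w, (extChartAt (𝓡 n) x₀).symm p) ∈ S.chronRel := by
  have key : ∀ w, S.TimelikeSegment w x₀ → ∃ p ∈ Metric.ball (extChartAt (𝓡 n) x₀ x₀) ρ,
      Γ.IsTimelike (S.chartTime x₀) p (extChartAt (𝓡 n) x₀ x₀) ∧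
      S.TimelikeSegment w ((extChartAt (𝓡 n) x₀).symm p) := by
    rintro w ⟨γ, hγ, rfl, h1, h⟩
    have h1mem := right_mem_Icc.2 (zero_le_one' ℝ)
    have hB : (extChartAt (𝓡 n) x₀).source ∩
        extChartAt (𝓡 n) x₀ ⁻¹' Metric.ball (extChartAt (𝓡 n) x₀ x₀) ρ ∈ 𝓝 (γ 1) := by
      rw [h1]
      exact Filter.inter_mem (extChartAt_source_mem_nhds x₀)
        ((continuousAt_extChartAt x₀).preimage_mem_nhds (Metric.ball_mem_nhds _ hρ))
    have hev : ∀ᶠ t in 𝓝[Icc (0 : ℝ) 1] 1, γ t ∈ (extChartAt (𝓡 n) x₀).source ∩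
        extChartAt (𝓡 n) x₀ ⁻¹' Metric.ball (extChartAt (𝓡 n) x₀ x₀) ρ :=
      (hγ.continuousOn 1 h1mem).eventually hB
    obtain ⟨ε, hε, hεB⟩ := Metric.mem_nhdsWithin_iff.1 hev
    -- Beyond `1 - ε / 2` the curve is in the ball; the bound `1 / 2` keeps `a` positive, so the
    -- part before `a` is a genuine segment.
    set a := max (1 / 2) (1 - ε / 2)
    have ha0 : 0 < a := (by norm_num : (0 : ℝ) < 1 / 2).trans_le (le_max_left _ _)
    have ha1 : a < 1 := max_lt (by norm_num) (by linarith)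
    have haε : 1 - ε / 2 ≤ a := le_max_right _ _
    have hmem : ∀ t ∈ Icc a 1, γ t ∈ (extChartAt (𝓡 n) x₀).source ∩
        extChartAt (𝓡 n) x₀ ⁻¹' Metric.ball (extChartAt (𝓡 n) x₀ x₀) ρ := by
      intro t ht
      refine hεB ⟨?_, ha0.le.trans ht.1, ht.2⟩
      rw [Metric.mem_ball, Real.dist_eq, abs_lt]
      constructor <;> linarith [ht.1, ht.2]
    obtain ⟨hs, hb⟩ := hmem a (left_mem_Icc.2 ha1.le)
    refine ⟨_, hb, ?_, ?_⟩
    · have := isTimelike_chart_of_curve (Γ := Γ) hG hγ h ha0.le le_rfl ha1 hmem hb (Or.inl rfl)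
      rwa [h1] at this
    · rw [(extChartAt (𝓡 n) x₀).left_inv hs]
      exact timelikeSegment_of_lt hγ h (left_mem_Icc.2 zero_le_one) ⟨ha0.le, ha1.le⟩ ha0
  cases (hw : Relation.TransGen S.TimelikeSegment w x₀) with
  | single hs =>
    obtain ⟨p, hp, h1, h2⟩ := key _ hs
    exact ⟨p, hp, h1, .single h2⟩
  | tail hwc hs =>
    obtain ⟨p, hp, h1, h2⟩ := key _ hs
    exact ⟨p, hp, h1, .tail hwc h2⟩

/-- A piecewise timelike curve which leaves a small ball crosses its boundary. -/
theorem exists_mem_sphere_isTimelike [T2Space M]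
    (hball : Metric.ball (extChartAt (𝓡 n) x₀ x₀) (4 * ρ) ⊆ (extChartAt (𝓡 n) x₀).target)
    (hG : IsLorentzMetricOn (S.chartMetric x₀) (S.chartTime x₀)
      (Metric.ball (extChartAt (𝓡 n) x₀ x₀) (4 * ρ))) {δ : ℝ} (hδ : δ < ρ) {w y : M}
    (hw : w ∈ (extChartAt (𝓡 n) x₀).source ∩
      extChartAt (𝓡 n) x₀ ⁻¹' Metric.ball (extChartAt (𝓡 n) x₀ x₀) δ)
    (hy : y ∉ (extChartAt (𝓡 n) x₀).source ∩
      extChartAt (𝓡 n) x₀ ⁻¹' Metric.ball (extChartAt (𝓡 n) x₀ x₀) δ)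
    (hwy : (w, y) ∈ S.chronRel) :
    ∃ z ∈ Metric.sphere (extChartAt (𝓡 n) x₀ x₀) δ,
      Γ.IsTimelike (S.chartTime x₀) (extChartAt (𝓡 n) x₀ w) z ∧
      ((extChartAt (𝓡 n) x₀).symm z = y ∨ ((extChartAt (𝓡 n) x₀).symm z, y) ∈ S.chronRel) := by
  have hρ : 0 < ρ := (Metric.pos_of_mem_ball hw.2).trans hδ
  have hcl : Metric.closedBall (extChartAt (𝓡 n) x₀ x₀) δ
      ⊆ Metric.ball (extChartAt (𝓡 n) x₀ x₀) ρ := Metric.closedBall_subset_ball hδ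
  have hclt := (hcl.trans (Metric.ball_subset_ball (by linarith : ρ ≤ 4 * ρ))).trans hball
  have hpw := hcl (Metric.ball_subset_closedBall hw.2)
  -- One segment either stays in the ball, carrying along the timelike relation to `w`, or meets the
  -- sphere. The alternative `q = w` in coordinates starts the induction over the chain.
  have key : ∀ q q', S.TimelikeSegment q q' → q ∈ (extChartAt (𝓡 n) x₀).source ∩
      extChartAt (𝓡 n) x₀ ⁻¹' Metric.ball (extChartAt (𝓡 n) x₀ x₀) δ →
      (extChartAt (𝓡 n) x₀ q = extChartAt (𝓡 n) x₀ w ∨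
        Γ.IsTimelike (S.chartTime x₀) (extChartAt (𝓡 n) x₀ w) (extChartAt (𝓡 n) x₀ q)) →
      (q' ∈ (extChartAt (𝓡 n) x₀).source ∩
        extChartAt (𝓡 n) x₀ ⁻¹' Metric.ball (extChartAt (𝓡 n) x₀ x₀) δ ∧
        Γ.IsTimelike (S.chartTime x₀) (extChartAt (𝓡 n) x₀ w) (extChartAt (𝓡 n) x₀ q')) ∨
      ∃ z ∈ Metric.sphere (extChartAt (𝓡 n) x₀ x₀) δ,
        Γ.IsTimelike (S.chartTime x₀) (extChartAt (𝓡 n) x₀ w) z ∧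
        ((extChartAt (𝓡 n) x₀).symm z = q' ∨
          S.TimelikeSegment ((extChartAt (𝓡 n) x₀).symm z) q') := by
    rintro q q' ⟨γ, hγ, rfl, rfl, h⟩ hq hqw
    by_cases hstay : ∀ t ∈ Icc (0 : ℝ) 1, γ t ∈ (extChartAt (𝓡 n) x₀).source ∩
      extChartAt (𝓡 n) x₀ ⁻¹' Metric.ball (extChartAt (𝓡 n) x₀ x₀) δ
    · refine .inl ⟨hstay 1 (right_mem_Icc.2 zero_le_one), ?_⟩
      exact isTimelike_chart_of_curve hG hγ h le_rfl le_rfl zero_lt_one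
        (fun t ht ↦ ⟨(hstay t ht).1, Metric.ball_subset_ball hδ.le (hstay t ht).2⟩) hpw hqw
    · obtain ⟨s, hs, hsph, hin⟩ := exists_mem_sphere_of_exit hγ.continuousOn hclt hq hstay
      refine .inr ⟨_, hsph, isTimelike_chart_of_curve hG hγ h le_rfl hs.2 hs.1
        (fun t ht ↦ ⟨(hin t ht).1, hcl (hin t ht).2⟩) hpw hqw, ?_⟩
      rw [(extChartAt (𝓡 n) x₀).left_inv (hin s (right_mem_Icc.2 hs.1.le)).1]
      rcases hs.2.eq_or_lt with rfl | hs1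
      · exact .inl rfl
      · exact .inr (timelikeSegment_of_lt hγ h ⟨hs.1.le, hs.2⟩ (right_mem_Icc.2 zero_le_one) hs1)
  have main : ∀ q, Relation.TransGen S.TimelikeSegment q y → q ∈ (extChartAt (𝓡 n) x₀).source ∩
      extChartAt (𝓡 n) x₀ ⁻¹' Metric.ball (extChartAt (𝓡 n) x₀ x₀) δ →
      (extChartAt (𝓡 n) x₀ q = extChartAt (𝓡 n) x₀ w ∨
        Γ.IsTimelike (S.chartTime x₀) (extChartAt (𝓡 n) x₀ w) (extChartAt (𝓡 n) x₀ q)) →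
      ∃ z ∈ Metric.sphere (extChartAt (𝓡 n) x₀ x₀) δ,
        Γ.IsTimelike (S.chartTime x₀) (extChartAt (𝓡 n) x₀ w) z ∧
        ((extChartAt (𝓡 n) x₀).symm z = y ∨ ((extChartAt (𝓡 n) x₀).symm z, y) ∈ S.chronRel) := by
    intro q hqy
    induction hqy using Relation.TransGen.head_induction_on with
    | single hseg =>
      intro hq hqw
      rcases key _ _ hseg hq hqw with ⟨h1, -⟩ | ⟨z, hz, h1, h2⟩
      · exact absurd h1 hy
      · exact ⟨z, hz, h1, h2.imp id .single⟩
    | head hseg hrest ih =>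
      intro hq hqw
      rcases key _ _ hseg hq hqw with ⟨h1, h2⟩ | ⟨z, hz, h1, h2⟩
      · exact ih h1 (.inr h2)
      · refine ⟨z, hz, h1, .inr ?_⟩
        rcases h2 with h2 | h2
        · rw [h2]; exact hrest
        · exact Relation.TransGen.head h2 hrest
  exact main w hwy hw (.inl rfl)

end Local

/-- Replace the last leg by a timelike geodesic from a nearby `p`; being timelike is an open
condition on its endpoint. -/
theorem isOpen_chronFuture (hM : IsManifold (𝓡 n) 3 M) (hn : 0 < n) (hr : 3 ≤ r)
    (S : Spacetime n r M) (x : M) : IsOpen (S.chronFuture x) := by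
  rw [isOpen_iff_mem_nhds]
  intro y hy
  obtain ⟨ρ, hρ, hball, hG, ⟨Γ⟩⟩ := exists_geodesicFamily_chart hM hn hr S y
  obtain ⟨p, hp, h1, h2⟩ := exists_isTimelike_of_chronRel (Γ := Γ) hρ hG hy
  have hc := continuousAt_extChartAt (I := 𝓡 n) y
  have hev := h1.eventually hG (Metric.mem_ball_self hρ) (P := fun _ ↦ p) tendsto_const_nhds hc
  filter_upwards [hev, extChartAt_source_mem_nhds (I := 𝓡 n) y,
    hc.preimage_mem_nhds (Metric.ball_mem_nhds _ hρ)] with y' h3 h4 h5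
  have := timelikeSegment_of_isTimelike hball hG hp h5 h3
  rw [(extChartAt (𝓡 n) y).left_inv h4] at this
  exact chronRel_trans h2 (.single this)

/-- The points with coordinates `φ x + ε • T`, for small `ε > 0`, lie in the future of `x` and
converge to it. -/
theorem mem_closure_chronFuture (hM : IsManifold (𝓡 n) 3 M) (hn : 0 < n) (hr : 3 ≤ r)
    (S : Spacetime n r M) (x : M) : x ∈ closure (S.chronFuture x) := by
  obtain ⟨ρ, hρ, hball, hG, ⟨Γ⟩⟩ := exists_geodesicFamily_chart hM hn hr S x
  set φ := extChartAt (𝓡 n) x with hφ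
  have hx := Metric.mem_ball_self (x := φ x) hρ
  have hT := hG.timelike (φ x) (mem_ball_four_mul hx)
  have hQ : Tendsto (fun ε : ℝ ↦ φ x + ε • S.chartTime x (φ x)) (𝓝[>] 0) (𝓝 (φ x)) := by
    have : Continuous fun ε : ℝ ↦ φ x + ε • S.chartTime x (φ x) := by fun_prop
    have h := this.tendsto 0
    rw [zero_smul, add_zero] at h
    exact h.mono_left nhdsWithin_le_nhds
  have hpos : ∀ᶠ ε : ℝ in 𝓝[>] 0, 0 < ε := self_mem_nhdsWithin
  have hev := GeodesicFamily.eventually_isTimelike (Γ := Γ) hG hx hT hT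
    (P := fun _ ↦ φ x) tendsto_const_nhds hQ hpos
    (tendsto_const_nhds.congr' (by
      filter_upwards [hpos] with ε hε
      rw [add_sub_cancel_left, inv_smul_smul₀ hε.ne']))
  have hsymm : Tendsto (fun ε : ℝ ↦ φ.symm (φ x + ε • S.chartTime x (φ x))) (𝓝[>] 0) (𝓝 x) := by
    have := (continuousAt_extChartAt_symm (I := 𝓡 n) x).tendsto.comp hQ
    rwa [extChartAt_to_inv] at this
  refine mem_closure_of_tendsto hsymm ?_
  filter_upwards [hev, hQ.eventually (Metric.ball_mem_nhds _ hρ)] with ε h1 h2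
  have := timelikeSegment_of_isTimelike hball hG hx h2 h1
  rw [extChartAt_to_inv] at this
  exact Relation.TransGen.single this

theorem mem_closure_chronPast (hM : IsManifold (𝓡 n) 3 M) (hn : 0 < n) (hr : 3 ≤ r)
    (S : Spacetime n r M) (x : M) : x ∈ closure (S.chronPast x) := by
  rw [← chronFuture_reverse]
  exact mem_closure_chronFuture hM hn hr S.reverse x

/-- For `u ≪ x` the open set `I⁺(u)` contains `x`, hence meets `I⁻(y)`. -/
theorem chronPast_subset_of_mem_closure (hM : IsManifold (𝓡 n) 3 M) (hn : 0 < n) (hr : 3 ≤ r)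
    (h : x ∈ closure (S.chronPast y)) : S.chronPast x ⊆ S.chronPast y := by
  intro u hu
  obtain ⟨v, hv1, hv2⟩ := mem_closure_iff.1 h _ (isOpen_chronFuture hM hn hr S u) hu
  exact chronRel_trans hv1 hv2

theorem FutureReflecting.D_eq_Dp (hM : IsManifold (𝓡 n) 3 M) (hn : 0 < n) (hr : 3 ≤ r)
    (h : S.FutureReflecting) : S.D = S.Dp := by
  refine inter_eq_left.2 fun p hp ↦ ?_
  exact closure_mono (h _ _ (chronPast_subset_of_mem_closure hM hn hr hp))
    (mem_closure_chronFuture hM hn hr S p.2)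

/-- Two distinct events with the same chronological past give rise to a third event in the causal
future of the first one, again with the same chronological past. -/
theorem exists_causalRel_chronPast_eq [T2Space M] [FirstCountableTopology M]
    (hM : IsManifold (𝓡 n) 3 M) (hn : 0 < n) (hr : 3 ≤ r) (hxy : x ≠ y)
    (h : S.chronPast x = S.chronPast y) :
    ∃ z, z ≠ x ∧ (x, z) ∈ S.causalRel ∧ S.chronPast z = S.chronPast x := by
  obtain ⟨ρ, hρ, hball, hG, ⟨Γ⟩⟩ := exists_geodesicFamily_chart hM hn hr S x
  set φ := extChartAt (𝓡 n) x with hφ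
  have hφx : φ.symm (φ x) = x := extChartAt_to_inv x
  -- The ball must miss `y`, so that curves to `y` exit; radius below `ρ / 4` is what push-up along
  -- the limit geodesic needs.
  obtain ⟨δ, hδ, hδρ, hyδ⟩ : ∃ δ > 0, δ < ρ / 4 ∧ ∀ z ∈ Metric.ball (φ x) δ, φ.symm z ≠ y := by
    have hev : ∀ᶠ z in 𝓝 (φ x), φ.symm z ≠ y :=
      (continuousAt_extChartAt_symm (I := 𝓡 n) x).eventually_ne (by rwa [← hφ, hφx])
    obtain ⟨ε, hε, hεy⟩ := Metric.mem_nhds_iff.1 hev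
    refine ⟨min ε (ρ / 4) / 2, by positivity, ?_, fun z hz ↦ hεy ?_⟩
    · linarith [min_le_right ε (ρ / 4)]
    · have : 0 < min ε (ρ / 4) := lt_min hε (by linarith)
      exact Metric.ball_subset_ball (by linarith [min_le_left ε (ρ / 4)]) hz
  have hδρ' : δ < ρ := by linarith
  have hyB : y ∉ φ.source ∩ φ ⁻¹' Metric.ball (φ x) δ := fun hy ↦
    hyδ _ hy.2 (φ.left_inv hy.1)
  have hxcl : x ∈ closure (S.chronPast y) := h ▸ mem_closure_chronPast hM hn hr S x
  obtain ⟨X, hX, hXx⟩ := mem_closure_iff_seq_limit.1 hxcl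
  have hXB : ∀ᶠ k in atTop, X k ∈ φ.source ∩ φ ⁻¹' Metric.ball (φ x) δ :=
    hXx.eventually (Filter.inter_mem (extChartAt_source_mem_nhds x)
      ((continuousAt_extChartAt x).preimage_mem_nhds (Metric.ball_mem_nhds _ hδ)))
  obtain ⟨N, hN⟩ := eventually_atTop.1 hXB
  have hexit : ∀ k, ∃ z ∈ Metric.sphere (φ x) δ,
      Γ.IsTimelike (S.chartTime x) (φ (X (k + N))) z ∧
        (φ.symm z = y ∨ (φ.symm z, y) ∈ S.chronRel) := fun k ↦
    exists_mem_sphere_isTimelike hball hG hδρ' (hN _ (Nat.le_add_left _ _)) hyB (hX _)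
  choose Z hZs hZt hZy using hexit
  -- The limit stays on the sphere of positive radius, hence differs from the centre.
  obtain ⟨z, hz, ψ, hψ, hZz⟩ := (isCompact_sphere (φ x) δ).tendsto_subseq hZs
  have hsb : Metric.sphere (φ x) δ ⊆ Metric.ball (φ x) (ρ / 4) :=
    Metric.sphere_subset_closedBall.trans (Metric.closedBall_subset_ball hδρ)
  have hle : ρ / 4 ≤ ρ := by linarith
  have hxb := Metric.mem_ball_self (x := φ x) hρ
  have hzb := Metric.ball_subset_ball hle (hsb hz)
  have hzt : z ∈ φ.target := hball (mem_ball_four_mul hzb)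
  have hzx : φ x ≠ z := by
    rintro rfl
    rw [Metric.mem_sphere, dist_self] at hz
    exact hδ.ne hz
  have hφX : Tendsto (fun k ↦ φ (X (ψ k + N))) atTop (𝓝 (φ x)) :=
    (continuousAt_extChartAt (I := 𝓡 n) x).tendsto.comp
      (((tendsto_add_atTop_iff_nat N).2 hXx).comp hψ.tendsto_atTop)
  have hcausal : Γ.IsCausal (S.chartTime x) (φ x) z :=
    GeodesicFamily.isCausal_of_tendsto hG hxb hzb hzx hφX hZz (.of_forall fun k ↦ hZt (ψ k))
  refine ⟨φ.symm z, fun he ↦ hzx ?_, ?_, subset_antisymm ?_ ?_⟩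
  · rw [← he, φ.right_inv hzt]
  · have := causalSegment_of_isCausal hball hG hxb hzb hzx hcausal
    rw [← hφ, hφx] at this
    exact Relation.ReflTransGen.single this
  · rw [h]
    refine chronPast_subset_of_mem_closure hM hn hr ?_
    have hlim : Tendsto (fun k ↦ φ.symm (Z (ψ k))) atTop (𝓝 (φ.symm z)) :=
      (continuousAt_extChartAt_symm'' hzt).tendsto.comp hZz
    refine isClosed_closure.mem_of_tendsto hlim (.of_forall fun k ↦ ?_)
    rcases hZy (ψ k) with he | he
    · rw [he]; exact mem_closure_chronPast hM hn hr S y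
    · exact subset_closure he
  -- Push-up: approach `x` along a last timelike leg from `p`, then follow the causal geodesic to
  -- `z`.
  · intro u hu
    obtain ⟨p, hp, h1, h2⟩ := exists_isTimelike_of_chronRel (Γ := Γ) hρ hG hu
    have h3 := h1.trans_isCausal hG hcausal hp (Metric.mem_ball_self (by linarith)) (hsb hz) hzx
    exact chronRel_trans h2 (.single (timelikeSegment_of_isTimelike hball hG hp hzb h3))

/-- The events `x` and `y` need not be causally related, so feeble distinction is applied to `x` and
the third event `z`, whose future equals that of `x` by reflectivity in both directions. -/
theorem FeeblyDistinguishing.pastDistinguishing [T2Space M] [FirstCountableTopology M]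
    (hM : IsManifold (𝓡 n) 3 M) (hn : 0 < n) (hr : 3 ≤ r)
    (hd : S.FeeblyDistinguishing) (h : S.FutureReflecting) : S.PastDistinguishing := by
  intro x y hxy
  by_contra hne
  obtain ⟨z, hzx, hxz, hpast⟩ := exists_causalRel_chronPast_eq hM hn hr hne hxy
  exact hzx (hd x z hxz (subset_antisymm (h z x hpast.subset) (h x z hpast.superset))
    hpast.symm).symm

theorem PastReflecting.reverse (h : S.PastReflecting) : S.reverse.FutureReflecting := by
  intro x y hxy
  rw [chronPast_reverse, chronPast_reverse] at hxy
  rw [chronFuture_reverse, chronFuture_reverse]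
  exact h y x hxy

theorem FeeblyDistinguishing.reverse (h : S.FeeblyDistinguishing) :
    S.reverse.FeeblyDistinguishing := by
  intro x y hxy hf hp
  rw [chronPast_reverse, chronPast_reverse] at hp
  rw [chronFuture_reverse, chronFuture_reverse] at hf
  exact (h y x (mem_causalRel_reverse.1 hxy) hp.symm hf.symm).symm

/-- Time reversal exchanges the two reflectivities, and turns `Df` into `Dp` with the pair swapped.
-/
theorem PastReflecting.D_eq_Df (hM : IsManifold (𝓡 n) 3 M) (hn : 0 < n) (hr : 3 ≤ r)
    (h : S.PastReflecting) : S.D = S.Df := by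
  have hrev := h.reverse.D_eq_Dp hM hn hr
  refine inter_eq_right.2 fun p hp ↦ ?_
  have h1 : (p.2, p.1) ∈ S.reverse.D := by
    rw [hrev, Dp, mem_ofPred_eq, chronPast_reverse]
    exact hp
  have h2 := h1.2
  rw [Df, mem_ofPred_eq, chronFuture_reverse] at h2
  exact h2

theorem FeeblyDistinguishing.futureDistinguishing [T2Space M] [FirstCountableTopology M]
    (hM : IsManifold (𝓡 n) 3 M) (hn : 0 < n) (hr : 3 ≤ r)
    (hd : S.FeeblyDistinguishing) (h : S.PastReflecting) : S.FutureDistinguishing := by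
  intro x y hxy
  refine hd.reverse.pastDistinguishing hM hn hr h.reverse x y ?_
  rwa [chronPast_reverse, chronPast_reverse]

end Spacetime

theorem mainTheorem2 (n : ℕ) (hn : 2 ≤ n) (r : ℕ∞) (hr : 3 ≤ r)
    (M : Type*) [TopologicalSpace M] [T2Space M] [SecondCountableTopology M] [ConnectedSpace M]
    [ChartedSpace (EuclideanSpace ℝ (Fin n)) M]
    [IsManifold (𝓡 n) (r : ℕ∞ω) M] [IsManifold (𝓡 n) 1 M]
    (S : Spacetime n r M) :
    (S.FutureReflecting → S.D = S.Dp) ∧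
    (S.PastReflecting → S.D = S.Df) ∧
    (S.FeeblyDistinguishing → S.FutureReflecting → S.PastDistinguishing) ∧
    (S.FeeblyDistinguishing → S.PastReflecting → S.FutureDistinguishing) := by
  have hn0 : 0 < n := by omega
  have hM : IsManifold (𝓡 n) 3 M :=
    IsManifold.of_le (n := (r : ℕ∞ω)) (WithTop.coe_le_coe.2 hr)
  exact ⟨fun h ↦ h.D_eq_Dp hM hn0 hr, fun h ↦ h.D_eq_Df hM hn0 hr,
    fun hd h ↦ hd.pastDistinguishing hM hn0 hr h,
    fun hd h ↦ hd.futureDistinguishing hM hn0 hr h⟩
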